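/- Let $k$ be an algebraically closed field of characteristic zero. Let $g\in k[x,y,z]$ be a cubic form defining a smooth plane cubic, and let $J(g)$ be the ideal generated by its partial derivatives. The Hessian of $g$ is the determinant $\mathrm{Hess}(g)$ of the matrix of second partial derivatives of $g$. The Macaulay polynomial (dual socle generator of the Jacobian ring $k[x,y,z]/J(g)$) is the nonzero cubic form $\mathrm{Mac}(g)$, determined up to a nonzero scalar, such that $J(g)=\{p\in k[x,y,z] : p(\partial_x,\partial_y,\partial_z)\,\mathrm{Mac}(g)=0\}$. Two forms are called projectively equivalent if one is obtained from the other by an invertible linear change of variables, up to a nonzero scalar. (1) Whether $\mathrm{Mac}(g)$ and $\mathrm{Hess}(g)$ are projectively equivalent depends only on the projective equivalence class of $g$, and there are exactly four projective equivalence classes of smooth plane cubics $g$ for which they are. (2) Put $f_a=x^3+y^3+z^3-3axyz$. For every $a\in k$ with $a\neq 0$ and $a^3\neq 1$, the form $\mathrm{Hess}(f_a)$ is a nonzero scalar multiple of $f_b$ with $b=\frac{4-a^3}{3a^2}$, and the Macaulay polynomials of $f_a$ are exactly the nonzero scalar multiples of $f_c$ with $c=-\frac{2}{a}$. -/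

import Mathlib

open MvPolynomial

noncomputable section

/-- The linear change of variables `f ↦ f(A x)`. -/
def linSubst {k : Type*} [Field k] {n : ℕ} (A : Matrix (Fin n) (Fin n) k) :
    MvPolynomial (Fin n) k →ₐ[k] MvPolynomial (Fin n) k :=
  aeval fun i => ∑ j, C (A i j) * X j

/-- Two polynomials are projectively equivalent if they agree, up to a nonzero scalar, after an
invertible linear change of variables. -/
def ProjEquiv {k : Type*} [Field k] {n : ℕ} (f g : MvPolynomial (Fin n) k) : Prop :=
  ∃ (A : GL (Fin n) k) (c : kˣ), g = (c : k) • linSubst (A : Matrix (Fin n) (Fin n) k) f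

theorem linSubst_one {k : Type*} [Field k] {n : ℕ} (f : MvPolynomial (Fin n) k) :
    linSubst (1 : Matrix (Fin n) (Fin n) k) f = f := by
  have h : linSubst (1 : Matrix (Fin n) (Fin n) k) = AlgHom.id k _ := by
    apply MvPolynomial.algHom_ext
    intro i
    simp [linSubst, Matrix.one_apply]
  rw [h, AlgHom.id_apply]

theorem linSubst_linSubst {k : Type*} [Field k] {n : ℕ} (A B : Matrix (Fin n) (Fin n) k)
    (f : MvPolynomial (Fin n) k) : linSubst B (linSubst A f) = linSubst (A * B) f := by
  have h : (linSubst B).comp (linSubst A) = linSubst (A * B) := by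
    apply MvPolynomial.algHom_ext
    intro i
    simp only [linSubst, AlgHom.comp_apply, aeval_X, map_sum, map_mul, algHom_C, Matrix.mul_apply,
      MvPolynomial.algebraMap_eq, Finset.mul_sum, Finset.sum_mul]
    rw [Finset.sum_comm]
    simp only [mul_assoc]
  rw [← h, AlgHom.comp_apply]

theorem ProjEquiv.refl {k : Type*} [Field k] {n : ℕ} (f : MvPolynomial (Fin n) k) :
    ProjEquiv f f :=
  ⟨1, 1, by simp [linSubst_one]⟩

theorem ProjEquiv.symm {k : Type*} [Field k] {n : ℕ} {f g : MvPolynomial (Fin n) k}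
    (h : ProjEquiv f g) : ProjEquiv g f := by
  obtain ⟨A, c, rfl⟩ := h
  refine ⟨A⁻¹, c⁻¹, ?_⟩
  rw [map_smul, linSubst_linSubst, ← Units.val_mul, mul_inv_cancel, Units.val_one, linSubst_one,
    smul_smul, ← Units.val_mul, inv_mul_cancel, Units.val_one, one_smul]

theorem ProjEquiv.trans {k : Type*} [Field k] {n : ℕ} {f g h : MvPolynomial (Fin n) k}
    (h₁ : ProjEquiv f g) (h₂ : ProjEquiv g h) : ProjEquiv f h := by
  obtain ⟨A, c, rfl⟩ := h₁
  obtain ⟨B, d, rfl⟩ := h₂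
  refine ⟨A * B, d * c, ?_⟩
  rw [map_smul, linSubst_linSubst, smul_smul, Units.val_mul, Units.val_mul]

/-- The differential monomial `∂₀ ^ m₀ ⋯ ∂ₙ₋₁ ^ mₙ₋₁`. -/
def diffMonomial {k : Type*} [Field k] {n : ℕ} (m : Fin n →₀ ℕ) :
    Module.End k (MvPolynomial (Fin n) k) :=
  (List.ofFn fun i : Fin n =>
    ((pderiv i : Derivation k (MvPolynomial (Fin n) k) (MvPolynomial (Fin n) k)) :
      MvPolynomial (Fin n) k →ₗ[k] MvPolynomial (Fin n) k) ^ m i).prod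

/-- The apolarity action `p(∂₀, …, ∂ₙ₋₁) f`. -/
def diffAction {k : Type*} [Field k] {n : ℕ} (p f : MvPolynomial (Fin n) k) :
    MvPolynomial (Fin n) k :=
  ∑ m ∈ p.support, p.coeff m • diffMonomial m f

/-- The ideal generated by the partial derivatives of `g`. -/
def jacobianIdeal {k : Type*} [Field k] {n : ℕ} (g : MvPolynomial (Fin n) k) :
    Ideal (MvPolynomial (Fin n) k) :=
  Ideal.span (Set.range fun i => pderiv i g)

/-- The determinant of the matrix of second order partial derivatives of `g`. -/
def hessian {k : Type*} [Field k] {n : ℕ} (g : MvPolynomial (Fin n) k) :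
    MvPolynomial (Fin n) k :=
  (Matrix.of fun i j => pderiv i (pderiv j g)).det

/-- `f` is a Macaulay polynomial (dual socle generator) of the Jacobian ring of the form `g` of
degree `d` in `n` variables: `f` is a form of degree `n (d - 2)` and the Jacobian ideal of `g` is
the annihilator `f^⊥` of `f` under differentiation. -/
def IsMacaulayPolynomial {k : Type*} [Field k] {n : ℕ} (d : ℕ) (g f : MvPolynomial (Fin n) k) :
    Prop :=
  f ≠ 0 ∧ f.IsHomogeneous (n * (d - 2)) ∧ ∀ p, p ∈ jacobianIdeal g ↔ diffAction p f = 0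

/-- The Macaulay polynomial of the form `g` of degree `d` is projectively equivalent to the
Hessian of `g`. -/
def MacaulayEquivHessian {k : Type*} [Field k] {n : ℕ} (d : ℕ) (g : MvPolynomial (Fin n) k) :
    Prop :=
  ∃ f, IsMacaulayPolynomial d g f ∧ ProjEquiv f (hessian g)

/-- The projective hypersurface `g = 0` has no singular point. -/
def IsSmoothForm {k : Type*} [Field k] {n : ℕ} (g : MvPolynomial (Fin n) k) : Prop :=
  ∀ v : Fin n → k, v ≠ 0 → eval v g = 0 → ∃ i, eval v (pderiv i g) ≠ 0

/-- Ternary cubic forms defining a smooth plane cubic (over an algebraically closed field). -/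
def SmoothPlaneCubic (k : Type*) [Field k] : Type _ :=
  {g : MvPolynomial (Fin 3) k // g.IsHomogeneous 3 ∧ IsSmoothForm g}

/-- Projective equivalence of smooth plane cubics. -/
def projSetoid (k : Type*) [Field k] : Setoid (SmoothPlaneCubic k) where
  r g h := ProjEquiv g.1 h.1
  iseqv := ⟨fun g => ProjEquiv.refl g.1, ProjEquiv.symm, ProjEquiv.trans⟩

/-- The member `x³ + y³ + z³ - 3 a x y z` of the Hesse pencil. -/
def hesseCubic {k : Type*} [Field k] (a : k) : MvPolynomial (Fin 3) k :=
  X 0 ^ 3 + X 1 ^ 3 + X 2 ^ 3 - C (3 * a) * (X 0 * X 1 * X 2)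

end

/-!
Every smooth plane cubic over an algebraically closed field of characteristic zero has a Hesse
normal form `f_a = x³ + y³ + z³ - 3axyz` with `a³ ≠ 1` (`exists_projEquiv_hesseCubic`). The Hessian
is covariant and the Macaulay polynomial contravariant under linear changes of variables
(`hessian_linSubst`, `IsMacaulayPolynomial.linSubst`), so it is enough to study the forms `f_a`.
Moreover `f_0` is equivalent to `f_{-2}`, so that `a ≠ 0` may be assumed. Then `Hess(f_a)` is
proportional to `f_b` with `b = (4 - a³) / (3a²)` by direct computation, and `Mac(f_a)` to `f_c`
with `c = -2 / a`: the forms killed by `∂ₓ² - a ∂_y∂_z` and its two companions are found by comparing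
coefficients, and conversely `f_c` pairs nondegenerately with the eight monomials
`1, x, y, z, yz, xz, xy, xyz` that span the Jacobian ring.

Smooth members of the Hesse pencil are classified by
`J(a) = a³ (a³ + 8)³ / (a³ - 1)³`, a multiple of the `j`-invariant. Equality of invariants is a
product over the cube roots of unity `ζ` of conditions `b³ = a³` or
`b³ = ((ζa + 2) / (ζa - 1))³`, and these are realised by diagonal matrices and the discrete Fourier
transform (`projEquiv_of_hesseInvariant_eq`). Conversely, a linear change of variables which maps
`f_a` to a multiple of `f_b` also maps `Hess(f_a)` to a multiple of `Hess(f_b)`, so it acts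
linearly on the whole Hesse pencil, and this action commutes up to a factor with the explicit cubic
map by which the Hessian acts on the pencil. Comparing coefficients determines the action and shows
that it preserves `J` (`hesseInvariant_eq_of_projEquiv`); no general invariant theory is needed.

With `J = J(a)` one has `J(c) = 4096 / J` and `J(b) = -(J - 256)³ / (27 J²)`. If `J = 0`, then `f_b`
and `f_c` are both triangles, hence equivalent; otherwise they are equivalent if and only if
`(J - 64) (J² - 704 J + 262144) = 0`. This gives four distinct values of `J`, each of which is
attained.

The normal form is obtained from a flex, that is, a common zero of the form and its Hessian; it
exists by the Nullstellensatz and Krull's height theorem (`exists_common_zero`, `exists_flex`).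
A root of a quartic then provides two more flexes collinear with the first one, and the form becomes
`M³ + L₁L₂L₃` up to constants, where `L₁ + L₂ + L₃` may be scaled to be a multiple of `M`. Since the
product `L₁L₂L₃` is a norm form `u³ + y³ + z³ - 3uyz` with `u` a multiple of `M`, this is a member
of the Hesse pencil.
-/

/-! ### The apolarity action in three variables -/

theorem pderiv_comm {k : Type*} [Field k] {n : ℕ} (i j : Fin n) (f : MvPolynomial (Fin n) k) :
    pderiv i (pderiv j f) = pderiv j (pderiv i f) := by
  induction f using MvPolynomial.induction_on with
  | C a => simp
  | add p q hp hq => simp [hp, hq]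
  | mul_X p l hp =>
    simp only [Derivation.leibniz, map_add, smul_eq_mul, pderiv_X, Pi.single_apply, hp]
    split_ifs <;> simp <;> ring

theorem pderiv_X_fin_three {k : Type*} [Field k] :
    (pderiv 0 (X 1 : MvPolynomial (Fin 3) k) = 0 ∧ pderiv 0 (X 2 : MvPolynomial (Fin 3) k) = 0) ∧
    (pderiv 1 (X 0 : MvPolynomial (Fin 3) k) = 0 ∧ pderiv 1 (X 2 : MvPolynomial (Fin 3) k) = 0) ∧
    (pderiv 2 (X 0 : MvPolynomial (Fin 3) k) = 0 ∧ pderiv 2 (X 1 : MvPolynomial (Fin 3) k) = 0) := by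
  simp [pderiv_X]

section Action

variable {k : Type*} [Field k]

theorem diffMonomial_fin_three (m : Fin 3 →₀ ℕ) :
    (diffMonomial m : Module.End k (MvPolynomial (Fin 3) k)) =
      ((pderiv 0).toLinearMap ^ m 0) * (((pderiv 1).toLinearMap ^ m 1) *
        ((pderiv 2).toLinearMap ^ m 2)) := by
  simp [diffMonomial, List.ofFn_succ]

theorem diffMonomial_add_single (m : Fin 3 →₀ ℕ) (i : Fin 3) :
    (diffMonomial (m + Finsupp.single i 1) : Module.End k (MvPolynomial (Fin 3) k)) =
      diffMonomial m * (pderiv i).toLinearMap := by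
  have hc : ∀ i j : Fin 3, Commute (pderiv i : Derivation k (MvPolynomial (Fin 3) k)
      (MvPolynomial (Fin 3) k)).toLinearMap (pderiv j).toLinearMap := fun i j =>
    LinearMap.ext fun f => pderiv_comm i j f
  rw [diffMonomial_fin_three, diffMonomial_fin_three]
  fin_cases i
  · have h1 := (hc 1 0).pow_left (m 1)
    have h2 := (hc 2 0).pow_left (m 2)
    simp only [Finsupp.add_apply, Fin.zero_eta, Finsupp.single_apply, if_true, Fin.reduceEq,
      if_false, add_zero, pow_succ, mul_assoc, h2.eq]
    rw [← mul_assoc _ _ ((pderiv 2).toLinearMap ^ m 2), ← h1.eq, mul_assoc]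
  · have h2 := (hc 2 1).pow_left (m 2)
    simp only [Finsupp.add_apply, Fin.mk_one, Finsupp.single_apply, if_true, Fin.reduceEq,
      if_false, add_zero, pow_succ, mul_assoc, h2.eq]
  · simp only [Finsupp.add_apply, Fin.reduceFinMk, Finsupp.single_apply, if_true, Fin.reduceEq,
      if_false, add_zero, pow_succ, mul_assoc]

theorem diffAction_eq_sum {n : ℕ} {p : MvPolynomial (Fin n) k} {s : Finset (Fin n →₀ ℕ)}
    (hs : p.support ⊆ s) (f : MvPolynomial (Fin n) k) :
    diffAction p f = ∑ m ∈ s, p.coeff m • diffMonomial m f := by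
  refine Finset.sum_subset hs fun m _ hm => ?_
  rw [notMem_support_iff.1 hm, zero_smul]

theorem diffAction_add {n : ℕ} (p q f : MvPolynomial (Fin n) k) :
    diffAction (p + q) f = diffAction p f + diffAction q f := by
  classical
  rw [diffAction_eq_sum (s := p.support ∪ q.support) support_add,
    diffAction_eq_sum (p := p) (s := p.support ∪ q.support) Finset.subset_union_left,
    diffAction_eq_sum (p := q) (s := p.support ∪ q.support) Finset.subset_union_right]
  simp only [coeff_add, add_smul, Finset.sum_add_distrib]

theorem diffAction_monomial {n : ℕ} (m : Fin n →₀ ℕ) (c : k) (f : MvPolynomial (Fin n) k) :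
    diffAction (monomial m c) f = c • diffMonomial m f := by
  classical
  rw [diffAction_eq_sum (s := {m}) support_monomial_subset, Finset.sum_singleton, coeff_monomial,
    if_pos rfl]

theorem diffAction_C (c : k) (f : MvPolynomial (Fin 3) k) : diffAction (C c) f = c • f := by
  rw [C_apply, diffAction_monomial, diffMonomial_fin_three]
  simp

theorem diffAction_add_right {n : ℕ} (p f g : MvPolynomial (Fin n) k) :
    diffAction p (f + g) = diffAction p f + diffAction p g := by
  simp [diffAction, Finset.sum_add_distrib]

theorem diffAction_smul_right {n : ℕ} (c : k) (p f : MvPolynomial (Fin n) k) :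
    diffAction p (c • f) = c • diffAction p f := by
  simp [diffAction, Finset.smul_sum, smul_comm c]

theorem diffAction_zero_right {n : ℕ} (p : MvPolynomial (Fin n) k) : diffAction p 0 = 0 := by
  simp [diffAction]

theorem diffAction_mul_X (p : MvPolynomial (Fin 3) k) (i : Fin 3) (f : MvPolynomial (Fin 3) k) :
    diffAction (p * X i) f = diffAction p (pderiv i f) := by
  induction p using MvPolynomial.induction_on' with
  | monomial m c =>
    have : (monomial m c : MvPolynomial (Fin 3) k) * X i = monomial (m + Finsupp.single i 1) c := by
      rw [X, monomial_mul, mul_one]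
    rw [this, diffAction_monomial, diffAction_monomial, diffMonomial_add_single]
    rfl
  | add p q hp hq => rw [add_mul, diffAction_add, hp, hq, diffAction_add]

theorem diffAction_mul (p q f : MvPolynomial (Fin 3) k) :
    diffAction (p * q) f = diffAction p (diffAction q f) := by
  induction q using MvPolynomial.induction_on generalizing f with
  | C a =>
    rw [diffAction_C, diffAction_smul_right]
    induction p using MvPolynomial.induction_on' with
    | monomial m c =>
      rw [mul_comm, C_mul_monomial, diffAction_monomial, diffAction_monomial, mul_smul]
    | add p q hp hq => rw [add_mul, diffAction_add, hp, hq, diffAction_add, smul_add]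
  | add q r hq hr => rw [mul_add, diffAction_add, hq, hr, diffAction_add, diffAction_add_right]
  | mul_X q i hq => rw [← mul_assoc, diffAction_mul_X, hq, diffAction_mul_X]

theorem diffAction_X (i : Fin 3) (f : MvPolynomial (Fin 3) k) :
    diffAction (X i) f = pderiv i f := by
  rw [← one_mul (X i), diffAction_mul_X, ← C_1, diffAction_C, one_smul]

theorem diffAction_C_mul (c : k) (p f : MvPolynomial (Fin 3) k) :
    diffAction (C c * p) f = c • diffAction p f := by
  rw [diffAction_mul, diffAction_C]

theorem diffAction_sub (p q f : MvPolynomial (Fin 3) k) :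
    diffAction (p - q) f = diffAction p f - diffAction q f := by
  rw [eq_sub_iff_add_eq, ← diffAction_add, sub_add_cancel]

theorem diffAction_sum {n : ℕ} {ι : Type*} (s : Finset ι) (p : ι → MvPolynomial (Fin n) k)
    (f : MvPolynomial (Fin n) k) :
    diffAction (∑ i ∈ s, p i) f = ∑ i ∈ s, diffAction (p i) f := by
  classical
  induction s using Finset.induction_on with
  | empty => simp [diffAction]
  | insert i s hi ih => rw [Finset.sum_insert hi, Finset.sum_insert hi, diffAction_add, ih]

/-! ### Behaviour under linear changes of variables -/

theorem pderiv_linSubst {n : ℕ} (A : Matrix (Fin n) (Fin n) k) (i : Fin n)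
    (f : MvPolynomial (Fin n) k) :
    pderiv i (linSubst A f) = ∑ j, C (A j i) * linSubst A (pderiv j f) := by
  induction f using MvPolynomial.induction_on with
  | C a => simp [linSubst]
  | add p q hp hq => simp only [map_add, hp, hq, mul_add, Finset.sum_add_distrib]
  | mul_X p l hp =>
    have hX : pderiv i (linSubst A (X l)) = C (A l i) := by
      simp [linSubst, pderiv_X, Pi.single_apply, Derivation.leibniz, mul_ite]
    simp only [map_mul, Derivation.leibniz, map_add, smul_eq_mul, hp, hX, mul_add,
      Finset.sum_add_distrib, pderiv_X, Finset.mul_sum]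
    congr 1
    · rw [Finset.sum_eq_single l]
      · simp [mul_comm]
      · intro j _ hj
        simp [hj.symm]
      · simp
    · exact Finset.sum_congr rfl fun j _ => by ring

theorem hessian_linSubst {n : ℕ} (A : Matrix (Fin n) (Fin n) k) (f : MvPolynomial (Fin n) k) :
    hessian (linSubst A f) = (A.det ^ 2) • linSubst A (hessian f) := by
  have h : (Matrix.of fun i j => pderiv i (pderiv j (linSubst A f))) =
      (A.map C).transpose * ((linSubst A).toRingHom.mapMatrix
        (Matrix.of fun i j => pderiv i (pderiv j f))) * A.map C := by
    ext1 i j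
    simp only [Matrix.of_apply, pderiv_linSubst, map_sum, Derivation.leibniz, smul_eq_mul,
      pderiv_C, Matrix.mul_apply, Matrix.transpose_apply, Matrix.map_apply, mul_zero, add_zero,
      RingHom.mapMatrix_apply, AlgHom.toRingHom_eq_coe, RingHom.coe_coe]
    refine Finset.sum_congr rfl fun l _ => ?_
    rw [mul_comm]
  have hd : (A.map (C : k → MvPolynomial (Fin n) k)).det = C A.det :=
    (RingHom.map_det (C : k →+* MvPolynomial (Fin n) k) A).symm
  rw [hessian, h, Matrix.det_mul, Matrix.det_mul, Matrix.det_transpose, hd, ← RingHom.map_det,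
    smul_eq_C_mul, hessian, C_pow]
  simp only [AlgHom.toRingHom_eq_coe, RingHom.coe_coe]
  ring

theorem hessian_smul {n : ℕ} (c : k) (f : MvPolynomial (Fin n) k) :
    hessian (c • f) = c ^ n • hessian f := by
  have h : (Matrix.of fun i j => pderiv i (pderiv j (c • f))) =
      (C c : MvPolynomial (Fin n) k) • Matrix.of fun i j => pderiv i (pderiv j f) := by
    ext1 i j
    simp [smul_eq_C_mul]
  rw [hessian, h, Matrix.det_smul, Fintype.card_fin, hessian, smul_eq_C_mul, C_pow]

theorem diffAction_linSubst (B : Matrix (Fin 3) (Fin 3) k) (p f : MvPolynomial (Fin 3) k) :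
    diffAction p (linSubst B f) = linSubst B (diffAction (linSubst B.transpose p) f) := by
  induction p using MvPolynomial.induction_on generalizing f with
  | C a => rw [diffAction_C, algHom_C, ← C_eq_algebraMap, diffAction_C, map_smul]
  | add p q hp hq => rw [diffAction_add, hp, hq, map_add, diffAction_add, map_add]
  | mul_X p i hp =>
    have hX : linSubst B.transpose (X i) = ∑ j, C (B j i) * X j := by
      simp [linSubst, Matrix.transpose_apply]
    rw [diffAction_mul_X, pderiv_linSubst, map_mul, diffAction_mul, hX, diffAction_sum]
    simp only [diffAction_C_mul, diffAction_X]
    simp only [← smul_eq_C_mul, ← map_smul, ← map_sum, hp]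

end Action

section Covariance

variable {k : Type*} [Field k]

theorem jacobianIdeal_smul {n : ℕ} {c : k} (hc : c ≠ 0) (g : MvPolynomial (Fin n) k) :
    jacobianIdeal (c • g) = jacobianIdeal g := by
  have h : ∀ (d : k) (f : MvPolynomial (Fin n) k), jacobianIdeal (d • f) ≤ jacobianIdeal f := by
    intro d f
    rw [jacobianIdeal, Ideal.span_le]
    rintro _ ⟨i, rfl⟩
    have hi : pderiv i f ∈ jacobianIdeal f := Ideal.subset_span ⟨i, rfl⟩
    simpa [smul_eq_C_mul] using Ideal.mul_mem_left _ (C d) hi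
  refine le_antisymm (h c g) ?_
  simpa [smul_smul, hc] using h c⁻¹ (c • g)

theorem linSubst_mem_jacobianIdeal {n : ℕ} {A B : Matrix (Fin n) (Fin n) k} (hAB : A * B = 1)
    {g p : MvPolynomial (Fin n) k} (hp : p ∈ jacobianIdeal g) :
    linSubst A p ∈ jacobianIdeal (linSubst A g) := by
  suffices h : jacobianIdeal g ≤ (jacobianIdeal (linSubst A g)).comap (linSubst A) from h hp
  rw [jacobianIdeal, Ideal.span_le]
  rintro _ ⟨j, rfl⟩
  rw [SetLike.mem_coe, Ideal.mem_comap]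
  have h : linSubst A (pderiv j g) = ∑ i, C (B i j) * pderiv i (linSubst A g) := by
    simp only [pderiv_linSubst, Finset.mul_sum, ← mul_assoc, ← C_mul]
    rw [Finset.sum_comm]
    simp only [← Finset.sum_mul, ← map_sum, mul_comm (B _ _), ← Matrix.mul_apply, hAB,
      Matrix.one_apply]
    simp
  rw [h]
  exact Ideal.sum_mem _ fun i _ => Ideal.mul_mem_left _ _ (Ideal.subset_span ⟨i, rfl⟩)

theorem isHomogeneous_linSubst {n d : ℕ} (A : Matrix (Fin n) (Fin n) k)
    {f : MvPolynomial (Fin n) k} (hf : f.IsHomogeneous d) : (linSubst A f).IsHomogeneous d := by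
  have h := hf.aeval (fun i => ∑ j, C (A i j) * X j) (n := 1) (fun i =>
    IsHomogeneous.sum _ _ _ fun j _ => by
      simpa using (isHomogeneous_C (Fin n) (A i j)).mul (isHomogeneous_X k j))
  rwa [one_mul] at h

/-- Macaulay polynomials are contravariant: a change of variables `A` in the form acts on its
dual socle generator by the inverse transpose of `A`. -/
theorem IsMacaulayPolynomial.linSubst {d : ℕ} {A B : Matrix (Fin 3) (Fin 3) k} (hAB : A * B = 1)
    {c : k} (hc : c ≠ 0) {g f : MvPolynomial (Fin 3) k} (h : IsMacaulayPolynomial d g f) :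
    IsMacaulayPolynomial d (c • linSubst A g) (linSubst B.transpose f) := by
  obtain ⟨h0, hh, hJ⟩ := h
  have hBA : B * A = 1 := mul_eq_one_comm.1 hAB
  have hinj : ∀ q : MvPolynomial (Fin 3) k, _root_.linSubst B.transpose q = 0 ↔ q = 0 := by
    refine fun q => ⟨fun hq => ?_, fun hq => by rw [hq, map_zero]⟩
    have := congrArg (_root_.linSubst A.transpose) hq
    rwa [linSubst_linSubst, ← Matrix.transpose_mul, hAB, Matrix.transpose_one, linSubst_one,
      map_zero] at this
  refine ⟨fun hf => h0 ((hinj f).1 hf), isHomogeneous_linSubst _ hh, fun p => ?_⟩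
  rw [diffAction_linSubst, hinj, Matrix.transpose_transpose, ← hJ, jacobianIdeal_smul hc]
  constructor
  · intro hp
    have := linSubst_mem_jacobianIdeal hBA hp
    rwa [linSubst_linSubst, hAB, linSubst_one] at this
  · intro hp
    have := linSubst_mem_jacobianIdeal hAB hp
    rwa [linSubst_linSubst, hBA, linSubst_one] at this

theorem MacaulayEquivHessian.of_projEquiv {d : ℕ} {g g' : MvPolynomial (Fin 3) k}
    (h : ProjEquiv g g') (hg : MacaulayEquivHessian d g) : MacaulayEquivHessian d g' := by
  obtain ⟨A, c, rfl⟩ := h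
  obtain ⟨f, hf, hfg⟩ := hg
  have hAB : (A : Matrix (Fin 3) (Fin 3) k) * (A⁻¹ : GL (Fin 3) k).1 = 1 := by
    rw [← Units.val_mul, mul_inv_cancel, Units.val_one]
  have hBA := mul_eq_one_comm.1 hAB
  refine ⟨_, hf.linSubst hAB c.ne_zero, ProjEquiv.trans (ProjEquiv.symm ?_) (hfg.trans ?_)⟩
  · exact ⟨⟨_, (A : Matrix (Fin 3) (Fin 3) k).transpose,
      by rw [← Matrix.transpose_mul, hAB, Matrix.transpose_one],
      by rw [← Matrix.transpose_mul, hBA, Matrix.transpose_one]⟩, 1, by simp⟩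
  · have hdet : (A : Matrix (Fin 3) (Fin 3) k).det ≠ 0 :=
      left_ne_zero_of_mul_eq_one (by rw [← Matrix.det_mul, hAB, Matrix.det_one])
    refine ⟨A, Units.mk0 ((c : k) ^ 3 * (A : Matrix (Fin 3) (Fin 3) k).det ^ 2)
      (mul_ne_zero (pow_ne_zero _ c.ne_zero) (pow_ne_zero _ hdet)), ?_⟩
    rw [hessian_smul, hessian_linSubst, smul_smul, Units.val_mk0]

theorem eval_linSubst {n : ℕ} (A : Matrix (Fin n) (Fin n) k) (v : Fin n → k)
    (f : MvPolynomial (Fin n) k) : eval v (linSubst A f) = eval (A.mulVec v) f := by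
  induction f using MvPolynomial.induction_on with
  | C a => simp [linSubst]
  | add p q hp hq => simp [hp, hq]
  | mul_X p i hp =>
    rw [map_mul, map_mul, hp, map_mul]
    simp [linSubst, Matrix.mulVec, dotProduct]

/-! ### The Hesse pencil -/

/-- The member of the Hesse pencil with homogeneous coordinates `(s, u)`; it is proportional to
`hesseCubic (u / s)` if `s ≠ 0`, and to the triangle `xyz` if `s = 0`. -/
noncomputable def hessePencil {k : Type*} [Field k] (s u : k) : MvPolynomial (Fin 3) k :=
  C s * (X 0 ^ 3 + X 1 ^ 3 + X 2 ^ 3) - C (3 * u) * (X 0 * X 1 * X 2)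

theorem hesseCubic_eq_hessePencil (a : k) : hesseCubic a = hessePencil 1 a := by
  simp [hesseCubic, hessePencil]

theorem smul_hessePencil (r s u : k) : r • hessePencil s u = hessePencil (r * s) (r * u) := by
  simp only [hessePencil, smul_eq_C_mul, C_mul]
  ring

theorem hessePencil_add (s u s' u' : k) :
    hessePencil (s + s') (u + u') = hessePencil s u + hessePencil s' u' := by
  simp only [hessePencil, C_mul, C_add]
  ring

theorem eval_hessePencil (s u : k) (v : Fin 3 → k) :
    eval v (hessePencil s u) = s * (v 0 ^ 3 + v 1 ^ 3 + v 2 ^ 3) - 3 * u * (v 0 * v 1 * v 2) := by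
  simp [hessePencil]

theorem hessePencil_inj [CharZero k] {s u s' u' : k} (h : hessePencil s u = hessePencil s' u') :
    s = s' ∧ u = u' := by
  have h1 := congrArg (eval ![1, 0, 0]) h
  have h2 := congrArg (eval ![1, 1, 1]) h
  simp [eval_hessePencil] at h1 h2
  refine ⟨h1, ?_⟩
  subst h1
  simpa using h2

theorem pderiv_hessePencil (s u : k) :
    pderiv 0 (hessePencil s u) = C (3 * s) * X 0 ^ 2 - C (3 * u) * (X 1 * X 2) ∧
    pderiv 1 (hessePencil s u) = C (3 * s) * X 1 ^ 2 - C (3 * u) * (X 0 * X 2) ∧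
    pderiv 2 (hessePencil s u) = C (3 * s) * X 2 ^ 2 - C (3 * u) * (X 0 * X 1) := by
  refine ⟨?_, ?_, ?_⟩ <;>
  · simp only [hessePencil, map_sub, map_add, Derivation.leibniz, Derivation.leibniz_pow, pderiv_C,
      pderiv_X_self, smul_eq_mul, nsmul_eq_mul, C_mul, pderiv_X_fin_three]
    rw [show (C (3 : k) : MvPolynomial (Fin 3) k) = 3 from map_ofNat C 3]
    push_cast
    ring

theorem hessian_hessePencil (s u : k) :
    hessian (hessePencil s u) = (18 : k) • hessePencil (-3 * (s * u ^ 2)) (u ^ 3 - 4 * s ^ 3) := by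
  obtain ⟨h0, h1, h2⟩ := pderiv_hessePencil s u
  rw [hessian, Matrix.det_fin_three]
  simp only [Matrix.of_apply, h0, h1, h2]
  simp only [map_sub, Derivation.leibniz, Derivation.leibniz_pow, pderiv_C,
      pderiv_X_self, smul_eq_mul, nsmul_eq_mul, C_mul, pderiv_X_fin_three]
  simp only [hessePencil, smul_eq_C_mul, C_mul, C_sub, C_neg, C_pow,
    show (C (3 : k) : MvPolynomial (Fin 3) k) = 3 from map_ofNat C 3,
    show (C (4 : k) : MvPolynomial (Fin 3) k) = 4 from map_ofNat C 4,
    show (C (18 : k) : MvPolynomial (Fin 3) k) = 18 from map_ofNat C 18]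
  push_cast
  ring

end Covariance

/-! ### Ternary cubic forms in coordinates -/

section Cubic

variable {k : Type*} [Field k]

/-- The ternary cubic form with prescribed coefficients. -/
noncomputable def ternaryCubic (c : Fin 10 → k) : MvPolynomial (Fin 3) k :=
  C (c 0) * X 0 ^ 3 + C (c 1) * X 1 ^ 3 + C (c 2) * X 2 ^ 3 + C (c 3) * (X 0 ^ 2 * X 1) +
    C (c 4) * (X 0 ^ 2 * X 2) + C (c 5) * (X 0 * X 1 ^ 2) + C (c 6) * (X 1 ^ 2 * X 2) +
    C (c 7) * (X 0 * X 2 ^ 2) + C (c 8) * (X 1 * X 2 ^ 2) + C (c 9) * (X 0 * X 1 * X 2)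

theorem ternaryCubic_add (c d : Fin 10 → k) :
    ternaryCubic (c + d) = ternaryCubic c + ternaryCubic d := by
  simp only [ternaryCubic, Pi.add_apply, C_add]
  ring

theorem monomial_fin_three (m : Fin 3 →₀ ℕ) (r : k) :
    monomial m r = C r * (X 0 ^ m 0 * X 1 ^ m 1 * X 2 ^ m 2) := by
  rw [monomial_eq, Finsupp.prod_fintype _ _ (fun i => pow_zero _), Fin.prod_univ_three]

theorem MvPolynomial.IsHomogeneous.exists_eq_ternaryCubic {f : MvPolynomial (Fin 3) k}
    (hf : f.IsHomogeneous 3) : ∃ c, f = ternaryCubic c := by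
  rw [f.as_sum]
  refine Finset.sum_induction _ (fun p => ∃ c : Fin 10 → k, p = ternaryCubic c) ?_
    ⟨0, by simp [ternaryCubic]⟩ ?_
  · rintro _ _ ⟨c, rfl⟩ ⟨d, rfl⟩
    exact ⟨c + d, (ternaryCubic_add c d).symm⟩
  · intro m hm
    have hdeg := hf (mem_support_iff.1 hm)
    rw [Finsupp.weight_apply, Finsupp.sum_fintype _ _ (fun i => by simp),
      Fin.sum_univ_three] at hdeg
    simp only [Pi.one_apply, smul_eq_mul, mul_one] at hdeg
    rw [monomial_fin_three]
    generalize coeff m f = r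
    have h2 : m 2 = 3 - m 0 - m 1 := by omega
    have h0 : m 0 ≤ 3 := by omega
    have h1 : m 0 + m 1 ≤ 3 := by omega
    rw [h2]
    generalize m 0 = i at *
    generalize m 1 = j at *
    have hj : j ≤ 3 - i := by omega
    interval_cases i <;> interval_cases j
    · exact ⟨Pi.single 2 r, by simp [ternaryCubic]⟩
    · exact ⟨Pi.single 8 r, by simp [ternaryCubic]⟩
    · exact ⟨Pi.single 6 r, by simp [ternaryCubic]⟩
    · exact ⟨Pi.single 1 r, by simp [ternaryCubic]⟩
    · exact ⟨Pi.single 7 r, by simp [ternaryCubic]⟩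
    · exact ⟨Pi.single 9 r, by simp [ternaryCubic]⟩
    · exact ⟨Pi.single 5 r, by simp [ternaryCubic]⟩
    · exact ⟨Pi.single 4 r, by simp [ternaryCubic]⟩
    · exact ⟨Pi.single 3 r, by simp [ternaryCubic]⟩
    · exact ⟨Pi.single 0 r, by simp [ternaryCubic]⟩

theorem pderiv_ternaryCubic (c : Fin 10 → k) :
    pderiv 0 (ternaryCubic c) = C (3 * c 0) * X 0 ^ 2 + C (2 * c 3) * (X 0 * X 1) +
      C (2 * c 4) * (X 0 * X 2) + C (c 5) * X 1 ^ 2 + C (c 7) * X 2 ^ 2 + C (c 9) * (X 1 * X 2) ∧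
    pderiv 1 (ternaryCubic c) = C (3 * c 1) * X 1 ^ 2 + C (c 3) * X 0 ^ 2 +
      C (2 * c 5) * (X 0 * X 1) + C (2 * c 6) * (X 1 * X 2) + C (c 8) * X 2 ^ 2 +
      C (c 9) * (X 0 * X 2) ∧
    pderiv 2 (ternaryCubic c) = C (3 * c 2) * X 2 ^ 2 + C (c 4) * X 0 ^ 2 + C (c 6) * X 1 ^ 2 +
      C (2 * c 7) * (X 0 * X 2) + C (2 * c 8) * (X 1 * X 2) + C (c 9) * (X 0 * X 1) := by
  refine ⟨?_, ?_, ?_⟩ <;>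
  · simp only [ternaryCubic, map_add, Derivation.leibniz, Derivation.leibniz_pow, pderiv_C,
      pderiv_X_self, smul_eq_mul, nsmul_eq_mul, C_mul, pderiv_X_fin_three,
      show (C (3 : k) : MvPolynomial (Fin 3) k) = 3 from map_ofNat C 3,
      show (C (2 : k) : MvPolynomial (Fin 3) k) = 2 from map_ofNat C 2]
    push_cast
    ring

theorem eval_ternaryCubic (c : Fin 10 → k) (v : Fin 3 → k) :
    eval v (ternaryCubic c) = c 0 * v 0 ^ 3 + c 1 * v 1 ^ 3 + c 2 * v 2 ^ 3 +
      c 3 * (v 0 ^ 2 * v 1) + c 4 * (v 0 ^ 2 * v 2) + c 5 * (v 0 * v 1 ^ 2) +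
      c 6 * (v 1 ^ 2 * v 2) + c 7 * (v 0 * v 2 ^ 2) + c 8 * (v 1 * v 2 ^ 2) +
      c 9 * (v 0 * v 1 * v 2) := by
  simp [ternaryCubic]

theorem isHomogeneous_hessePencil (s u : k) : (hessePencil s u).IsHomogeneous 3 := by
  have hX : ∀ i : Fin 3, (X i : MvPolynomial (Fin 3) k).IsHomogeneous 1 := isHomogeneous_X k
  have hC : ∀ r : k, (C r : MvPolynomial (Fin 3) k).IsHomogeneous 0 := isHomogeneous_C _
  have h3 : ∀ i : Fin 3, (X i ^ 3 : MvPolynomial (Fin 3) k).IsHomogeneous 3 := fun i =>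
    (hX i).pow 3
  rw [hessePencil]
  refine IsHomogeneous.sub ?_ ?_
  · simpa using (hC s).mul (((h3 0).add (h3 1)).add (h3 2))
  · simpa using (hC (3 * u)).mul (((hX 0).mul (hX 1)).mul (hX 2))

/-! ### The Macaulay polynomial of a member of the Hesse pencil -/

theorem diffAction_eq_zero_of_mem_jacobianIdeal {g f p : MvPolynomial (Fin 3) k}
    (h : ∀ i, diffAction (pderiv i g) f = 0) (hp : p ∈ jacobianIdeal g) : diffAction p f = 0 := by
  induction hp using Submodule.span_induction with
  | mem _ h' => obtain ⟨i, rfl⟩ := h'; exact h i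
  | zero => simp [diffAction]
  | add p q _ _ hp hq => rw [diffAction_add, hp, hq, add_zero]
  | smul q p _ hp => rw [smul_eq_mul, diffAction_mul, hp, diffAction_zero_right]

theorem diffAction_pderiv_hessePencil (s u : k) (f : MvPolynomial (Fin 3) k) :
    diffAction (pderiv 0 (hessePencil s u)) f =
      (3 * s) • pderiv 0 (pderiv 0 f) - (3 * u) • pderiv 1 (pderiv 2 f) ∧
    diffAction (pderiv 1 (hessePencil s u)) f =
      (3 * s) • pderiv 1 (pderiv 1 f) - (3 * u) • pderiv 0 (pderiv 2 f) ∧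
    diffAction (pderiv 2 (hessePencil s u)) f =
      (3 * s) • pderiv 2 (pderiv 2 f) - (3 * u) • pderiv 0 (pderiv 1 f) := by
  obtain ⟨h0, h1, h2⟩ := pderiv_hessePencil s u
  simp only [h0, h1, h2, diffAction_sub, diffAction_C, diffAction_mul, diffAction_X, sq, and_self]

/-- Modulo the Jacobian ideal of a smooth member of the Hesse pencil every polynomial is a linear
combination of `1, x, y, z, yz, xz, xy, xyz`. -/
theorem exists_normalForm_mod_jacobianIdeal [CharZero k] {a : k} (ha : a ^ 3 ≠ 1)
    (p : MvPolynomial (Fin 3) k) :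
    ∃ c : Fin 8 → k, p - (C (c 0) + C (c 1) * X 0 + C (c 2) * X 1 + C (c 3) * X 2 +
      C (c 4) * (X 1 * X 2) + C (c 5) * (X 0 * X 2) + C (c 6) * (X 0 * X 1) +
      C (c 7) * (X 0 * X 1 * X 2)) ∈ jacobianIdeal (hesseCubic a) := by
  rw [hesseCubic_eq_hessePencil]
  set J := jacobianIdeal (hessePencil 1 a) with hJ
  set φ := Ideal.Quotient.mk J with hφ
  obtain ⟨h0, h1, h2⟩ := pderiv_hessePencil 1 a
  have hC : (C (3 : k)⁻¹ : MvPolynomial (Fin 3) k) * C 3 = 1 := by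
    rw [← C_mul, inv_mul_cancel₀ (by norm_num), C_1]
  have hmem : ∀ i, φ (C 3⁻¹ * pderiv i (hessePencil 1 a)) = 0 := fun i =>
    Ideal.Quotient.eq_zero_iff_mem.2 (Ideal.mul_mem_left _ _ (Ideal.subset_span ⟨i, rfl⟩))
  have hx : φ (X 0) ^ 2 = φ (C a) * (φ (X 1) * φ (X 2)) := by
    rw [← sub_eq_zero, ← hmem 0, h0, ← map_pow, ← map_mul, ← map_mul, ← map_sub]
    congr 1
    simp only [C_mul, C_1]
    linear_combination (X 0 ^ 2 - C a * (X 1 * X 2)) * (-hC)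
  have hy : φ (X 1) ^ 2 = φ (C a) * (φ (X 0) * φ (X 2)) := by
    rw [← sub_eq_zero, ← hmem 1, h1, ← map_pow, ← map_mul, ← map_mul, ← map_sub]
    congr 1
    simp only [C_mul, C_1]
    linear_combination (X 1 ^ 2 - C a * (X 0 * X 2)) * (-hC)
  have hz : φ (X 2) ^ 2 = φ (C a) * (φ (X 0) * φ (X 1)) := by
    rw [← sub_eq_zero, ← hmem 2, h2, ← map_pow, ← map_mul, ← map_mul, ← map_sub]
    congr 1
    simp only [C_mul, C_1]
    linear_combination (X 2 ^ 2 - C a * (X 0 * X 1)) * (-hC)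
  have hi : φ (C (1 - a ^ 3)⁻¹) * (1 - φ (C a) ^ 3) = 1 := by
    rw [← map_pow, ← map_one φ, ← map_sub, ← map_mul, ← C_pow, ← C_1, ← C_sub, ← C_mul,
      inv_mul_cancel₀ (sub_ne_zero.2 ha.symm)]
  -- The six monomials of the shape `x²y` vanish, because `x²y = a y²z = a² z²x = a³ x²y`.
  have key : ∀ {x y z : MvPolynomial (Fin 3) k ⧸ J}, x ^ 2 = φ (C a) * (y * z) →
      y ^ 2 = φ (C a) * (x * z) → z ^ 2 = φ (C a) * (x * y) → x ^ 2 * y = 0 := by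
    intro x y z hx hy hz
    linear_combination (-(x ^ 2 * y)) * hi + φ (C (1 - a ^ 3)⁻¹) *
      (y * hx + φ (C a) * z * hy + φ (C a) ^ 2 * x * hz)
  have hxy := key hx hy hz
  have hxz := key (y := φ (X 2)) (z := φ (X 1)) (by rw [hx]; ring) hz hy
  have hyx := key (x := φ (X 1)) (y := φ (X 0)) (z := φ (X 2)) hy hx (by rw [hz]; ring)
  have hyz := key (x := φ (X 1)) (y := φ (X 2)) (z := φ (X 0)) (by rw [hy]; ring) (by rw [hz]; ring)
    (by rw [hx])
  have hzx := key (x := φ (X 2)) (y := φ (X 0)) (z := φ (X 1)) hz (by rw [hx]; ring)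
    (by rw [hy]; ring)
  have hzy := key (x := φ (X 2)) (y := φ (X 1)) (z := φ (X 0)) (by rw [hz]; ring) (by rw [hy]; ring)
    (by rw [hx]; ring)
  simp only [← Ideal.Quotient.eq_zero_iff_mem, ← hφ]
  simp only [map_sub, map_add, map_mul, sub_eq_zero]
  induction p using MvPolynomial.induction_on with
  | C r => exact ⟨![r, 0, 0, 0, 0, 0, 0, 0], by simp⟩
  | add p q hp hq =>
    obtain ⟨c, hc⟩ := hp
    obtain ⟨d, hd⟩ := hq
    refine ⟨c + d, ?_⟩
    simp only [map_add, hc, hd, Pi.add_apply]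
    ring
  | mul_X p i hp =>
    obtain ⟨c, hc⟩ := hp
    rw [map_mul, hc]
    fin_cases i
    · refine ⟨![0, c 0, 0, 0, a * c 1, c 3, c 2, c 4], ?_⟩
      simp
      linear_combination φ (C (c 1)) * hx + φ (C (c 5)) * hxz + φ (C (c 6)) * hxy +
        φ (C (c 7)) * φ (X 2) * hxy
    · refine ⟨![0, 0, c 0, 0, c 3, a * c 2, c 1, c 5], ?_⟩
      simp
      linear_combination φ (C (c 2)) * hy + φ (C (c 4)) * hyz + φ (C (c 6)) * hyx +
        φ (C (c 7)) * φ (X 2) * hyx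
    · refine ⟨![0, 0, 0, c 0, c 2, c 1, a * c 3, c 6], ?_⟩
      simp
      linear_combination φ (C (c 3)) * hz + φ (C (c 4)) * hzy + φ (C (c 5)) * hzx +
        φ (C (c 7)) * φ (X 1) * hzx

theorem pderiv_pderiv_hessePencil (s u : k) :
    pderiv 0 (pderiv 0 (hessePencil s u)) = C (6 * s) * X 0 ∧
    pderiv 1 (pderiv 1 (hessePencil s u)) = C (6 * s) * X 1 ∧
    pderiv 2 (pderiv 2 (hessePencil s u)) = C (6 * s) * X 2 ∧
    pderiv 1 (pderiv 2 (hessePencil s u)) = - C (3 * u) * X 0 ∧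
    pderiv 0 (pderiv 2 (hessePencil s u)) = - C (3 * u) * X 1 ∧
    pderiv 0 (pderiv 1 (hessePencil s u)) = - C (3 * u) * X 2 := by
  obtain ⟨h0, h1, h2⟩ := pderiv_hessePencil s u
  rw [h0, h1, h2]
  refine ⟨?_, ?_, ?_, ?_, ?_, ?_⟩ <;>
  · simp only [map_sub, Derivation.leibniz, Derivation.leibniz_pow, pderiv_C,
      pderiv_X_self, smul_eq_mul, nsmul_eq_mul,
      pderiv_X_fin_three]
    simp only [C_mul, show (C (3 : k) : MvPolynomial (Fin 3) k) = 3 from map_ofNat C 3,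
      show (C (6 : k) : MvPolynomial (Fin 3) k) = 6 from map_ofNat C 6]
    push_cast
    ring

theorem isMacaulayPolynomial_smul {n d : ℕ} {g f : MvPolynomial (Fin n) k} {r : k} (hr : r ≠ 0)
    (h : IsMacaulayPolynomial d g f) : IsMacaulayPolynomial d g (r • f) := by
  obtain ⟨h0, hh, hJ⟩ := h
  refine ⟨smul_ne_zero hr h0, ?_, fun p => ?_⟩
  · simpa [smul_eq_C_mul] using (isHomogeneous_C (Fin n) r).mul hh
  · rw [diffAction_smul_right, smul_eq_zero_iff_right hr, hJ]

theorem isMacaulayPolynomial_hesseCubic [CharZero k] {a : k} (ha0 : a ≠ 0) (ha : a ^ 3 ≠ 1) :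
    IsMacaulayPolynomial 3 (hesseCubic a) (hesseCubic (-2 / a)) := by
  have hc0 : (-2 / a) ≠ 0 := div_ne_zero (by norm_num) ha0
  have hac : a * (-2 / a) = -2 := by field_simp
  generalize -2 / a = c at hc0 hac
  rw [hesseCubic_eq_hessePencil c]
  refine ⟨fun h => ?_, isHomogeneous_hessePencil _ _, fun p => ?_⟩
  · simpa [eval_hessePencil] using congrArg (eval ![1, 0, 0]) h
  obtain ⟨e00, e11, e22, e12, e02, e01⟩ := pderiv_pderiv_hessePencil 1 c
  have hkill : ∀ q ∈ jacobianIdeal (hesseCubic a), diffAction q (hessePencil 1 c) = 0 := by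
    intro q hq
    refine diffAction_eq_zero_of_mem_jacobianIdeal (fun i => ?_) hq
    obtain ⟨h0, h1, h2⟩ := diffAction_pderiv_hessePencil 1 a (hessePencil 1 c)
    have hC : (C a : MvPolynomial (Fin 3) k) * C c = -2 := by
      rw [← C_mul, hac, C_neg, map_ofNat]
    rw [hesseCubic_eq_hessePencil]
    have e3 : (C (3 : k) : MvPolynomial (Fin 3) k) = 3 := map_ofNat C 3
    have e6 : (C (6 : k) : MvPolynomial (Fin 3) k) = 6 := map_ofNat C 6
    fin_cases i <;> simp only [Fin.zero_eta, Fin.mk_one, Fin.reduceFinMk, h0, h1, h2, e00, e11, e22,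
      e12, e02, e01, smul_eq_C_mul, C_mul, C_1, e3, e6]
    · linear_combination 9 * X 0 * hC
    · linear_combination 9 * X 1 * hC
    · linear_combination 9 * X 2 * hC
  refine ⟨hkill p, fun hp => ?_⟩
  obtain ⟨v, hv⟩ := exists_normalForm_mod_jacobianIdeal ha p
  have hv0 := hkill _ hv
  rw [diffAction_sub, hp, zero_sub, neg_eq_zero] at hv0
  obtain ⟨d0, d1, d2⟩ := pderiv_hessePencil 1 c
  simp only [diffAction_add, diffAction_mul, diffAction_X, diffAction_C, d0, d1, d2]
    at hv0
  have hev : ∀ w : Fin 3 → k, _ := fun w => congrArg (eval w) hv0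
  simp only [map_add, smul_eval, eval_hessePencil, map_sub, map_mul, eval_C, map_pow, eval_X,
    map_zero, Derivation.leibniz, pderiv_X_self, pderiv_C, smul_eq_mul,
    map_one, mul_zero, add_zero] at hev
  have z0 := hev ![0, 0, 0]
  simp [hc0] at z0
  have hcancel : ∀ {α β γ : k}, α + 3 * β - 3 * c * γ = 0 → - α + 3 * β + 3 * c * γ = 0 →
      8 * α + 12 * β - 6 * c * γ = 0 → α = 0 ∧ β = 0 ∧ γ = 0 := by
    intro α β γ h1 h2 h3
    have hβ : β = 0 := by linear_combination (h1 + h2) / 6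
    have hα : α = 0 := by linear_combination (h3 - 2 * h1) / 6 - hβ
    refine ⟨hα, hβ, ?_⟩
    have : c * γ = 0 := by linear_combination (hα + 3 * hβ - h1) / 3
    exact (mul_eq_zero.1 this).resolve_left hc0
  have hx := hcancel (α := v 0) (β := v 1) (γ := v 4)
    (by have := hev ![1, 0, 0]; simp [z0] at this; linear_combination this)
    (by have := hev ![-1, 0, 0]; simp [z0] at this; linear_combination this)
    (by have := hev ![2, 0, 0]; simp [z0] at this; linear_combination this)
  have hy := hcancel (α := v 0) (β := v 2) (γ := v 5)
    (by have := hev ![0, 1, 0]; simp [z0] at this; linear_combination this)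
    (by have := hev ![0, -1, 0]; simp [z0] at this; linear_combination this)
    (by have := hev ![0, 2, 0]; simp [z0] at this; linear_combination this)
  have hz := hcancel (α := v 0) (β := v 3) (γ := v 6)
    (by have := hev ![0, 0, 1]; simp [z0] at this; linear_combination this)
    (by have := hev ![0, 0, -1]; simp [z0] at this; linear_combination this)
    (by have := hev ![0, 0, 2]; simp [z0] at this; linear_combination this)
  simpa [z0, hx.1, hx.2.1, hx.2.2, hy.2.1, hy.2.2, hz.2.1, hz.2.2] using hv

theorem IsMacaulayPolynomial.eq_smul_hesseCubic [CharZero k] {a : k} (ha0 : a ≠ 0) (ha : a ^ 3 ≠ 1)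
    {f : MvPolynomial (Fin 3) k} (h : IsMacaulayPolynomial 3 (hesseCubic a) f) :
    ∃ r : k, r ≠ 0 ∧ f = r • hesseCubic (-2 / a) := by
  obtain ⟨h0, hh, hJ⟩ := h
  obtain ⟨c, rfl⟩ := hh.exists_eq_ternaryCubic
  have hk : ∀ i, diffAction (pderiv i (hesseCubic a)) (ternaryCubic c) = 0 := fun i =>
    (hJ _).1 (Ideal.subset_span ⟨i, rfl⟩)
  rw [hesseCubic_eq_hessePencil] at hk
  obtain ⟨h0', h1', h2'⟩ := diffAction_pderiv_hessePencil 1 a (ternaryCubic c)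
  obtain ⟨d0, d1, d2⟩ := pderiv_ternaryCubic c
  have k0 := h0'.symm.trans (hk 0)
  have k1 := h1'.symm.trans (hk 1)
  have k2 := h2'.symm.trans (hk 2)
  simp only [d0, d1, d2, map_add, Derivation.leibniz, Derivation.leibniz_pow, pderiv_C,
      pderiv_X_self, smul_eq_mul, nsmul_eq_mul,
      pderiv_X_fin_three]
    at k0 k1 k2
  have hev0 := fun w : Fin 3 → k => congrArg (eval w) k0
  have hev1 := fun w : Fin 3 → k => congrArg (eval w) k1
  have hev2 := fun w : Fin 3 → k => congrArg (eval w) k2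
  simp only [map_add, smul_eval, map_sub, map_mul, eval_C, map_pow, eval_X, map_zero,
    mul_zero, add_zero, zero_add, mul_one, map_natCast] at hev0 hev1 hev2
  have x0 := hev0 ![1, 0, 0]
  have x1 := hev0 ![0, 1, 0]
  have x2 := hev0 ![0, 0, 1]
  have y0 := hev1 ![1, 0, 0]
  have y1 := hev1 ![0, 1, 0]
  have y2 := hev1 ![0, 0, 1]
  have z0 := hev2 ![1, 0, 0]
  have z1 := hev2 ![0, 1, 0]
  have z2 := hev2 ![0, 0, 1]
  simp at x0 x1 x2 y0 y1 y2 z0 z1 z2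
  have ha' : 1 - a ^ 3 ≠ 0 := sub_ne_zero.2 ha.symm
  have h3 : c 3 = 0 := (mul_eq_zero.1 (show (1 - a ^ 3) * c 3 = 0 by
    linear_combination (x1 + a * y2 + a ^ 2 * z0) / 6)).resolve_left ha'
  have h4 : c 4 = 0 := (mul_eq_zero.1 (show (1 - a ^ 3) * c 4 = 0 by
    linear_combination (x2 + a * z1 + a ^ 2 * y0) / 6)).resolve_left ha'
  have h5 : c 5 = 0 := by linear_combination y0 / 6 + a * h4
  have h7 : c 7 = 0 := by linear_combination z0 / 6 + a * h3
  have h6 : c 6 = 0 := by linear_combination y2 / 6 + a * h7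
  have h8 : c 8 = 0 := by linear_combination z1 / 6 + a * h5
  have h1 : c 1 = c 0 := by linear_combination (y1 - x0) / 18
  have h2 : c 2 = c 0 := by linear_combination (z2 - x0) / 18
  have h9 : c 9 = c 0 * (6 / a) := by
    field_simp
    linear_combination -x0 / 3
  have hf : ternaryCubic c = c 0 • hesseCubic (-2 / a) := by
    rw [ternaryCubic, hesseCubic, h1, h2, h3, h4, h5, h6, h7, h8, h9, smul_eq_C_mul,
      show 3 * (-2 / a) = -(6 / a) by ring, C_mul, C_neg]
    simp only [C_0]
    ring
  refine ⟨c 0, fun hc => h0 ?_, hf⟩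
  rw [hf, hc, zero_smul]

end Cubic

/-! ### Projective equivalence within the Hesse pencil -/

section Equivalence

variable {k : Type*} [Field k]

/-- Up to a constant factor, the `j`-invariant of the cubic `x³ + y³ + z³ - 3axyz`. -/
noncomputable def hesseInvariant {k : Type*} [Field k] (a : k) : k :=
  a ^ 3 * (a ^ 3 + 8) ^ 3 / (a ^ 3 - 1) ^ 3

theorem projEquiv_of_eval [Infinite k] {n : ℕ} {f g : MvPolynomial (Fin n) k}
    {A B : Matrix (Fin n) (Fin n) k} (hAB : A * B = 1) {c : k} (hc : c ≠ 0)
    (h : ∀ v, eval v g = c * eval (A.mulVec v) f) : ProjEquiv f g := by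
  refine ⟨⟨A, B, hAB, mul_eq_one_comm.1 hAB⟩, Units.mk0 c hc, MvPolynomial.funext fun v => ?_⟩
  rw [h v, smul_eval, eval_linSubst, Units.val_mk0]

theorem projEquiv_of_eval_of_det_ne_zero [Infinite k] {n : ℕ} {f g : MvPolynomial (Fin n) k}
    {A : Matrix (Fin n) (Fin n) k} (hA : A.det ≠ 0) {c : k} (hc : c ≠ 0)
    (h : ∀ v, eval v g = c * eval (A.mulVec v) f) : ProjEquiv f g :=
  projEquiv_of_eval (Matrix.mul_nonsing_inv A (isUnit_iff_ne_zero.2 hA)) hc h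

theorem projEquiv_smul {n : ℕ} (f : MvPolynomial (Fin n) k) {c : k} (hc : c ≠ 0) :
    ProjEquiv f (c • f) :=
  ⟨1, Units.mk0 c hc, by simp [linSubst_one]⟩

theorem projEquiv_hesseCubic_of_pow_eq [CharZero k] {a b : k} (h : a ^ 3 = b ^ 3) :
    ProjEquiv (hesseCubic a) (hesseCubic b) := by
  by_cases ha : a = 0
  · have hb : b = 0 := by
      rw [ha, zero_pow three_ne_zero] at h
      exact eq_zero_of_pow_eq_zero h.symm
    rw [ha, hb]
    exact ProjEquiv.refl _
  refine projEquiv_of_eval_of_det_ne_zero (A := Matrix.diagonal ![1, 1, b / a]) ?_ one_ne_zero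
    fun v => ?_
  · have hb : b ≠ 0 := by
      rintro rfl
      rw [zero_pow three_ne_zero] at h
      exact ha (eq_zero_of_pow_eq_zero h)
    simp [Fin.prod_univ_three, ha, hb]
  · simp only [hesseCubic_eq_hessePencil, eval_hessePencil, Matrix.mulVec_diagonal]
    simp only [Matrix.cons_val]
    field_simp
    linear_combination (v 2 ^ 3) * h

/-- The norm form of the group algebra of the cyclic group of order three is a product of three
linear forms. -/
theorem norm_form_eq_mul {ω : k} (hω : ω ^ 2 + ω + 1 = 0) (x y z : k) :
    (x + y + z) * (x + ω * y + ω ^ 2 * z) * (x + ω ^ 2 * y + ω * z) =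
      x ^ 3 + y ^ 3 + z ^ 3 - 3 * (x * y * z) := by
  grind

theorem sum_cubes_fourier {ω : k} (hω : ω ^ 2 + ω + 1 = 0) (x y z : k) :
    (x + y + z) ^ 3 + (x + ω * y + ω ^ 2 * z) ^ 3 + (x + ω ^ 2 * y + ω * z) ^ 3 =
      3 * (x ^ 3 + y ^ 3 + z ^ 3) + 18 * (x * y * z) := by
  grind

/-- The discrete Fourier transform of order three maps the Hesse pencil to itself. -/
theorem projEquiv_hesseCubic_fourier [CharZero k] {ω : k} (hω : ω ^ 2 + ω + 1 = 0) {a : k}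
    (ha : a ≠ 1) : ProjEquiv (hesseCubic a) (hesseCubic ((a + 2) / (a - 1))) := by
  have ha' : a - 1 ≠ 0 := sub_ne_zero.2 ha
  refine projEquiv_of_eval_of_det_ne_zero (A := !![1, 1, 1; 1, ω, ω ^ 2; 1, ω ^ 2, ω])
    (c := -(3 * (a - 1))⁻¹) ?_ (neg_ne_zero.2 (inv_ne_zero (mul_ne_zero three_ne_zero ha'))) ?_
  · intro h
    have h' : 3 * ω * (1 - ω) = 0 := by
      rw [Matrix.det_fin_three] at h
      simp at h
      linear_combination -h - (ω ^ 2 - ω) * hω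
    have h3 : (3 : k) * 3 = 0 := by
      linear_combination ω ^ 2 * (1 - ω ^ 2) * h' + (-9 * (ω - 1) - 3 * ω ^ 3 * (ω - 2)) * hω
    norm_num at h3
  · intro v
    simp only [hesseCubic_eq_hessePencil, eval_hessePencil, Matrix.mulVec, dotProduct,
      Fin.sum_univ_three]
    simp only [Matrix.of_apply, Matrix.cons_val, one_mul]
    rw [norm_form_eq_mul hω, sum_cubes_fourier hω]
    field_simp
    ring

theorem hesseInvariant_fourier [CharZero k] {m b : k} (hm : m ^ 3 ≠ 1)
    (h : b ^ 3 * (m - 1) ^ 3 = (m + 2) ^ 3) : hesseInvariant b = hesseInvariant m := by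
  have hm1 : m - 1 ≠ 0 := fun h0 => hm (by rw [sub_eq_zero.1 h0, one_pow])
  have hm2 : m ^ 2 + m + 1 ≠ 0 := fun h0 => hm (by linear_combination (m - 1) * h0)
  have hb : b ^ 3 = (m + 2) ^ 3 / (m - 1) ^ 3 := by
    rw [eq_div_iff (pow_ne_zero 3 hm1), h]
  have e1 : b ^ 3 - 1 = 9 * (m ^ 2 + m + 1) / (m - 1) ^ 3 := by
    rw [hb]
    field_simp
    ring
  have e2 : b ^ 3 + 8 = 9 * (m * (m ^ 2 - 2 * m + 4)) / (m - 1) ^ 3 := by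
    rw [hb]
    field_simp
    ring
  rw [hesseInvariant, hesseInvariant, e1, e2, hb,
    show m ^ 3 - 1 = (m - 1) * (m ^ 2 + m + 1) by ring,
    show m ^ 3 + 8 = (m + 2) * (m ^ 2 - 2 * m + 4) by ring]
  field_simp

/-- The map of pencil coordinates which describes the Hessian. If a linear substitution commutes
with it up to a factor, it belongs to the tetrahedral group which permutes the four triangles of
the Hesse pencil, and `hesseInvariant` is an invariant of this group. -/
theorem hesseInvariant_eq_of_commute [CharZero k] {α β γ δ κ : k} (hdet : α * δ - β * γ ≠ 0)
    (h1 : ∀ s u : k, α * (-3 * (s * u ^ 2)) + β * (u ^ 3 - 4 * s ^ 3) =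
      κ * (-3 * ((α * s + β * u) * (γ * s + δ * u) ^ 2)))
    (h2 : ∀ s u : k, γ * (-3 * (s * u ^ 2)) + δ * (u ^ 3 - 4 * s ^ 3) =
      κ * ((γ * s + δ * u) ^ 3 - 4 * (α * s + β * u) ^ 3))
    {a b r : k} (ha : a ^ 3 ≠ 1) (hs : α + β * a = r)
    (hu : γ + δ * a = r * b) :
    hesseInvariant a = hesseInvariant b := by
  have p1 := h1 1 0
  have p2 := h1 0 1
  have p3 := h1 1 1
  have p4 := h1 1 (-1)
  have q1 := h2 1 0
  have q2 := h2 0 1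
  have q3 := h2 1 1
  have q4 := h2 1 (-1)
  simp only [mul_one, mul_zero, zero_mul, add_zero, zero_add, one_mul] at p1 p2 q1 q2
  have e1 : 4 * β = 3 * κ * (α * γ ^ 2) := by linear_combination -p1
  have e2 : β = -3 * κ * (β * δ ^ 2) := by linear_combination p2
  have e3 : α = κ * (α * δ ^ 2 + 2 * β * γ * δ) := by linear_combination -(p3 + p4) / 6 + p1 / 3
  have e4 : κ * (γ * (β * γ + 2 * α * δ)) = 0 := by
    linear_combination (p3 - p4) / 6 - p2 / 3
  have f1 : -4 * δ = κ * (γ ^ 3 - 4 * α ^ 3) := by linear_combination q1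
  have f2 : δ = κ * (δ ^ 3 - 4 * β ^ 3) := by linear_combination q2
  have hκ : κ ≠ 0 := by
    rintro rfl
    have hβ : β = 0 := by linear_combination e2
    have hδ : δ = 0 := by linear_combination f2
    exact hdet (by rw [hβ, hδ]; ring)
  by_cases hβ : β = 0
  · subst hβ
    have hγ : γ = 0 := by
      have hα : α ≠ 0 := by rintro rfl; simp at hdet
      have : κ * α * γ ^ 2 = 0 := by linear_combination -e1 / 3
      simpa [hκ, hα] using this
    subst hγ
    have hδ : δ ≠ 0 := by rintro rfl; simp at hdet
    have hα : α ≠ 0 := by rintro rfl; simp at hdet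
    have h3 : α ^ 3 = δ ^ 3 := mul_left_cancel₀ hκ (by linear_combination f1 / 4 + f2)
    have hab : α ^ 3 * a ^ 3 = α ^ 3 * b ^ 3 := by
      rw [zero_add] at hu
      rw [zero_mul, add_zero] at hs
      have : (δ * a) ^ 3 = (α * b) ^ 3 := by rw [hu, hs]
      linear_combination this + a ^ 3 * h3
    rw [hesseInvariant, hesseInvariant, mul_left_cancel₀ (pow_ne_zero 3 hα) hab]
  · have hδ2 : -3 * κ * δ ^ 2 = 1 := mul_left_cancel₀ hβ (by linear_combination -e2)
    have hδ : δ ≠ 0 := by rintro rfl; simp at hδ2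
    have hγ : γ ≠ 0 := by
      rintro rfl
      exact hβ (by linear_combination e1 / 4)
    have hβγ : β * γ = -2 * α * δ := by
      have := (mul_eq_zero.1 ((mul_eq_zero.1 e4).resolve_left hκ)).resolve_left hγ
      linear_combination this
    have hβ3 : β ^ 3 = δ ^ 3 := by linear_combination (-3 * δ ^ 2 / 4) * f2 +
      (δ ^ 3 - 4 * β ^ 3) / 4 * hδ2
    have hα3 : α ^ 3 = - δ ^ 3 := by
      have h4 : 4 * β * δ ^ 2 = - α * γ ^ 2 := by
        linear_combination δ ^ 2 * e1 - α * γ ^ 2 * hδ2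
      refine mul_left_cancel₀ (pow_ne_zero 2 hδ) ?_
      linear_combination β ^ 2 / 4 * h4 - δ ^ 2 * hβ3 - α / 4 * (β * γ - 2 * α * δ) * hβγ
    have hα : α ≠ 0 := by
      rintro rfl
      refine hδ (eq_zero_of_pow_eq_zero (n := 3) ?_)
      linear_combination hα3
    -- In terms of `m = -βa/α`, a cube root of unity times `a`, the substitution is
    -- `m ↦ (m + 2) / (m - 1)`.
    have hm : (-β * a / α) ^ 3 = a ^ 3 := by
      field_simp
      linear_combination -a ^ 3 * (hβ3 + hα3)
    have hrb : ((-β * a - α) * (β * b)) ^ 3 = (δ * (-β * a + 2 * α)) ^ 3 := by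
      congr 1
      linear_combination - β * b * hs + β * hu - hβγ
    rw [hesseInvariant, ← hm, ← hesseInvariant]
    refine (hesseInvariant_fourier (hm ▸ ha) ?_).symm
    field_simp
    refine mul_left_cancel₀ (pow_ne_zero 3 hδ) ?_
    linear_combination hrb - b ^ 3 * (-β * a - α) ^ 3 * hβ3

theorem hesseInvariant_eq_of_projEquiv [CharZero k] {a b : k} (ha : a ^ 3 ≠ 1)
    (h : ProjEquiv (hesseCubic a) (hesseCubic b)) : hesseInvariant a = hesseInvariant b := by
  obtain ⟨A, c, h⟩ := h
  set B : Matrix (Fin 3) (Fin 3) k := A.1 with hB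
  have hd : B.det ^ 2 ≠ 0 := pow_ne_zero 2 (left_ne_zero_of_mul_eq_one (b := (A⁻¹).1.det) (by
    rw [← Matrix.det_mul, hB, ← Units.val_mul, mul_inv_cancel, Units.val_one, Matrix.det_one]))
  set d := B.det ^ 2 with hd'
  rw [hesseCubic_eq_hessePencil, hesseCubic_eq_hessePencil] at h
  have hH := congrArg hessian h
  rw [hessian_smul, hessian_linSubst, hessian_hessePencil, hessian_hessePencil] at hH
  simp only [← hd', map_smul, smul_smul] at hH
  -- The substitution maps two spanning members of the pencil into the pencil.
  obtain ⟨r, hr, hrc⟩ : ∃ r : k, r ≠ 0 ∧ r * c = 1 :=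
    ⟨(c : k)⁻¹, inv_ne_zero c.ne_zero, inv_mul_cancel₀ c.ne_zero⟩
  have g1 : linSubst B (hessePencil 1 a) = hessePencil r (r * b) := by
    have := congrArg (fun p => r • p) h
    simp only [smul_smul, hrc, one_smul, smul_hessePencil, mul_one] at this
    exact this.symm
  obtain ⟨s', u', g2⟩ : ∃ s' u', linSubst B (hessePencil (-3 * (1 * a ^ 2)) (a ^ 3 - 4 * 1 ^ 3)) =
      hessePencil s' u' := by
    have hcd : (c ^ 3 * (d * 18) : k) ≠ 0 :=
      mul_ne_zero (pow_ne_zero 3 c.ne_zero) (mul_ne_zero hd (by norm_num))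
    have := (eq_inv_smul_iff₀ hcd).2 hH.symm
    rw [smul_hessePencil, smul_hessePencil] at this
    exact ⟨_, _, this⟩
  have hW : a ^ 3 - 1 ≠ 0 := sub_ne_zero.2 ha
  have hlin : ∀ s u : k, hessePencil s u = s • hessePencil 1 0 + u • hessePencil 0 1 := by
    intro s u
    simp only [smul_hessePencil, ← hessePencil_add]
    simp
  have g1' := g1
  have g2' := g2
  rw [hlin 1 a, map_add, map_smul, map_smul] at g1'
  rw [hlin (-3 * _), map_add, map_smul, map_smul] at g2'
  obtain ⟨α, γ, g3⟩ : ∃ α γ, linSubst B (hessePencil 1 0) = hessePencil α γ := by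
    have : linSubst B (hessePencil 1 0) = ((4 * (a ^ 3 - 1))⁻¹ * (a ^ 3 - 4)) •
        hessePencil r (r * b) + (-(4 * (a ^ 3 - 1))⁻¹ * a) • hessePencil s' u' := by
      rw [← g1', ← g2']
      match_scalars <;> field_simp <;> ring
    rw [this, smul_hessePencil, smul_hessePencil, ← hessePencil_add]
    exact ⟨_, _, rfl⟩
  obtain ⟨β, δ, g4⟩ : ∃ β δ, linSubst B (hessePencil 0 1) = hessePencil β δ := by
    have : linSubst B (hessePencil 0 1) = ((4 * (a ^ 3 - 1))⁻¹ * (3 * a ^ 2)) •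
        hessePencil r (r * b) + (4 * (a ^ 3 - 1))⁻¹ • hessePencil s' u' := by
      rw [← g1', ← g2']
      match_scalars <;> field_simp <;> ring
    rw [this, smul_hessePencil, smul_hessePencil, ← hessePencil_add]
    exact ⟨_, _, rfl⟩
  have hP : ∀ s u, linSubst B (hessePencil s u) = hessePencil (α * s + β * u) (γ * s + δ * u) := by
    intro s u
    rw [hlin, map_add, map_smul, map_smul, g3, g4, smul_hessePencil, smul_hessePencil,
      ← hessePencil_add]
    congr 1 <;> ring
  have hcomm := fun s u =>
    (hessian_linSubst B (hessePencil s u)).symm.trans (congrArg hessian (hP s u))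
  simp only [hessian_hessePencil, hP, smul_hessePencil, ← hd'] at hcomm
  have h18 : (18 : k) ≠ 0 := by norm_num
  obtain ⟨hs, hu⟩ := hessePencil_inj ((hP 1 a).symm.trans g1)
  refine hesseInvariant_eq_of_commute (α := α) (β := β) (γ := γ) (δ := δ) (κ := d⁻¹) ?_
    (fun s u => ?_) (fun s u => ?_) (r := r) ha (by linear_combination hs)
    (by linear_combination hu)
  · intro h0
    have k1 : linSubst B (hessePencil δ (-γ)) = linSubst B (hessePencil 0 0) := by
      rw [hP, hP]
      congr 1
      · linear_combination h0
      · ring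
    have k2 : linSubst B (hessePencil β (-α)) = linSubst B (hessePencil 0 0) := by
      rw [hP, hP]
      congr 1
      · ring
      · linear_combination -h0
    have hinj : Function.Injective (linSubst B) := by
      refine Function.LeftInverse.injective (g := linSubst (A⁻¹).1) fun f => ?_
      rw [linSubst_linSubst, hB, ← Units.val_mul, mul_inv_cancel, Units.val_one, linSubst_one]
    obtain ⟨hδ, hγ⟩ := hessePencil_inj (hinj k1)
    obtain ⟨hβ, hα⟩ := hessePencil_inj (hinj k2)
    rw [neg_eq_zero] at hγ hα
    refine hr ?_
    rw [← hs, hα, hβ]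
    ring
  · have := (hessePencil_inj (hcomm s u)).1
    field_simp
    refine mul_left_cancel₀ h18 ?_
    linear_combination this
  · have := (hessePencil_inj (hcomm s u)).2
    field_simp
    refine mul_left_cancel₀ h18 ?_
    linear_combination this

theorem exists_cube_root_of_unity [IsAlgClosed k] [CharZero k] : ∃ ω : k, ω ^ 2 + ω + 1 = 0 := by
  obtain ⟨s, hs⟩ := IsAlgClosed.exists_pow_nat_eq (-3 : k) (n := 2) (by norm_num)
  exact ⟨(-1 + s) / 2, by linear_combination hs / 4⟩

theorem projEquiv_of_hesseInvariant_eq [IsAlgClosed k] [CharZero k] {a b : k} (ha : a ^ 3 ≠ 1)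
    (hb : b ^ 3 ≠ 1) (h : hesseInvariant a = hesseInvariant b) :
    ProjEquiv (hesseCubic a) (hesseCubic b) := by
  obtain ⟨ω, hω⟩ := exists_cube_root_of_unity (k := k)
  have hω3 : ω ^ 3 = 1 := by linear_combination (ω - 1) * hω
  have key : ∀ m : k, m ^ 3 = a ^ 3 → b ^ 3 * (m - 1) ^ 3 - (m + 2) ^ 3 = 0 →
      ProjEquiv (hesseCubic a) (hesseCubic b) := by
    intro m hm hmb
    have hm1 : m ≠ 1 := by
      rintro rfl
      exact ha (by rw [← hm, one_pow])
    refine (projEquiv_hesseCubic_of_pow_eq hm.symm).trans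
      ((projEquiv_hesseCubic_fourier hω hm1).trans (projEquiv_hesseCubic_of_pow_eq ?_))
    rw [div_pow, div_eq_iff (pow_ne_zero 3 (sub_ne_zero.2 hm1))]
    linear_combination -hmb
  rw [hesseInvariant, hesseInvariant, div_eq_div_iff (pow_ne_zero 3 (sub_ne_zero.2 ha))
    (pow_ne_zero 3 (sub_ne_zero.2 hb))] at h
  -- The product of the factors `b³(m-1)³ - (m+2)³` over the three cube roots `m` of `a³` is a norm.
  have hN := norm_form_eq_mul hω (b ^ 3 * (a ^ 3 - 1) - (a ^ 3 + 8)) ((3 * b ^ 3 - 12) * a)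
    (-(3 * b ^ 3 + 6) * a ^ 2)
  have hprod : (a ^ 3 - b ^ 3) * ((b ^ 3 * (a - 1) ^ 3 - (a + 2) ^ 3) *
      (b ^ 3 * (ω * a - 1) ^ 3 - (ω * a + 2) ^ 3) *
      (b ^ 3 * (ω ^ 2 * a - 1) ^ 3 - (ω ^ 2 * a + 2) ^ 3)) = 0 := by
    have e0 : b ^ 3 * (a - 1) ^ 3 - (a + 2) ^ 3 = b ^ 3 * (a ^ 3 - 1) - (a ^ 3 + 8) +
        (3 * b ^ 3 - 12) * a + -(3 * b ^ 3 + 6) * a ^ 2 := by ring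
    have e1 : b ^ 3 * (ω * a - 1) ^ 3 - (ω * a + 2) ^ 3 = b ^ 3 * (a ^ 3 - 1) - (a ^ 3 + 8) +
        ω * ((3 * b ^ 3 - 12) * a) + ω ^ 2 * (-(3 * b ^ 3 + 6) * a ^ 2) := by
      linear_combination (b ^ 3 - 1) * a ^ 3 * hω3
    have e2 : b ^ 3 * (ω ^ 2 * a - 1) ^ 3 - (ω ^ 2 * a + 2) ^ 3 =
        b ^ 3 * (a ^ 3 - 1) - (a ^ 3 + 8) +
        ω ^ 2 * ((3 * b ^ 3 - 12) * a) + ω * (-(3 * b ^ 3 + 6) * a ^ 2) := by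
      linear_combination ((b ^ 3 - 1) * a ^ 3 * (ω ^ 3 + 1) - ω * (3 * b ^ 3 + 6) * a ^ 2) * hω3
    rw [e0, e1, e2, hN]
    linear_combination h
  rcases mul_eq_zero.1 hprod with h0 | h0
  · exact projEquiv_hesseCubic_of_pow_eq (sub_eq_zero.1 h0)
  rcases mul_eq_zero.1 h0 with h0 | h0
  · rcases mul_eq_zero.1 h0 with h0 | h0
    · exact key a rfl h0
    · exact key (ω * a) (by linear_combination a ^ 3 * hω3) h0
  · exact key (ω ^ 2 * a) (by linear_combination a ^ 3 * (ω ^ 3 + 1) * hω3) h0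

end Equivalence

/-! ### Existence of flexes -/

section Flex

variable {k : Type*} [Field k]

/-- Two polynomials in three variables which vanish at the origin have another common zero:
otherwise the Nullstellensatz would make the maximal ideal of the origin, which has height at
least three, minimal over an ideal with two generators. -/
theorem exists_common_zero [IsAlgClosed k] {f g : MvPolynomial (Fin 3) k} (hf : eval 0 f = 0)
    (hg : eval 0 g = 0) : ∃ v : Fin 3 → k, v ≠ 0 ∧ eval v f = 0 ∧ eval v g = 0 := by
  by_contra! hcon
  set φ₁ : MvPolynomial (Fin 3) k →ₐ[k] MvPolynomial (Fin 3) k := aeval ![0, X 1, X 2]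
  set φ₂ : MvPolynomial (Fin 3) k →ₐ[k] MvPolynomial (Fin 3) k := aeval ![0, 0, X 2]
  set φ₃ : MvPolynomial (Fin 3) k →ₐ[k] MvPolynomial (Fin 3) k := aeval ![0, 0, 0]
  have h₁₂ : φ₂ = φ₂.comp φ₁ := by
    ext i : 1
    fin_cases i <;> simp [φ₁, φ₂]
  have h₂₃ : φ₃ = φ₃.comp φ₂ := by
    ext i : 1
    fin_cases i <;> simp [φ₂, φ₃]
  set P₁ := RingHom.ker φ₁
  set P₂ := RingHom.ker φ₂
  set P₃ := RingHom.ker φ₃ with hP₃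
  have : P₁.IsPrime := RingHom.ker_isPrime _
  have : P₂.IsPrime := RingHom.ker_isPrime _
  have : P₃.IsPrime := RingHom.ker_isPrime _
  have l₁ : (⊥ : Ideal (MvPolynomial (Fin 3) k)) < P₁ := by
    refine bot_lt_iff_ne_bot.2 fun h => ?_
    have : (X 0 : MvPolynomial (Fin 3) k) ∈ P₁ := by simp [P₁, φ₁, RingHom.mem_ker]
    rw [h, Ideal.mem_bot] at this
    exact X_ne_zero _ this
  have l₂ : P₁ < P₂ := by
    refine SetLike.lt_iff_le_and_exists.2 ⟨fun p hp => ?_, X 1, ?_, ?_⟩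
    · rw [RingHom.mem_ker] at hp ⊢
      rw [h₁₂, AlgHom.comp_apply, hp, map_zero]
    · simp [P₂, φ₂, RingHom.mem_ker]
    · simp [P₁, φ₁, RingHom.mem_ker]
  have l₃ : P₂ < P₃ := by
    refine SetLike.lt_iff_le_and_exists.2 ⟨fun p hp => ?_, X 2, ?_, ?_⟩
    · rw [RingHom.mem_ker] at hp ⊢
      rw [h₂₃, AlgHom.comp_apply, hp, map_zero]
    · simp [P₃, φ₃, RingHom.mem_ker]
    · simp [P₂, φ₂, RingHom.mem_ker]
  have ht : (3 : ℕ∞) ≤ P₃.height := by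
    have a₁ := Ideal.height_add_one_le_of_lt_of_isPrime l₁
    have a₂ := Ideal.height_add_one_le_of_lt_of_isPrime l₂
    have a₃ := Ideal.height_add_one_le_of_lt_of_isPrime l₃
    rw [Ideal.height_bot, zero_add] at a₁
    calc (3 : ℕ∞) = 1 + 1 + 1 := by norm_num
      _ ≤ P₁.height + 1 + 1 := by gcongr
      _ ≤ P₂.height + 1 := by gcongr
      _ ≤ P₃.height := a₃
  have hφ₃ : ∀ p, φ₃ p = C (eval 0 p) := by
    intro p
    have : φ₃ = (Algebra.ofId k (MvPolynomial (Fin 3) k)).comp (aeval (0 : Fin 3 → k)) := by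
      ext i : 1
      fin_cases i <;> simp [φ₃]
    rw [this, AlgHom.comp_apply, ← coe_aeval_eq_eval]
    rfl
  have hrad : (Ideal.span {f, g}).radical = P₃ := by
    rw [← vanishingIdeal_zeroLocus_eq_radical (k := k) (K := k)]
    have hz : zeroLocus k (Ideal.span {f, g}) = {0} := by
      rw [zeroLocus_span]
      ext v
      simp only [Set.mem_insert_iff, Set.mem_singleton_iff, Set.mem_ofPred_eq, forall_eq_or_imp,
        forall_eq]
      refine ⟨fun h => ?_, fun h => ?_⟩
      · by_contra hv
        exact hcon v hv h.1 h.2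
      · subst h
        exact ⟨hf, hg⟩
    ext p
    rw [hz, mem_vanishingIdeal_singleton_iff, RingHom.mem_ker, hφ₃, C_eq_zero]
    rfl
  have hmin : P₃ ∈ (Ideal.span {f, g}).minimalPrimes := by
    rw [← Ideal.radical_minimalPrimes, hrad, Ideal.minimalPrimes_eq_subsingleton_self]
    exact Set.mem_singleton _
  classical
  have hle := Ideal.height_le_card_of_mem_minimalPrimes_span_finset (s := {f, g})
    (by simpa using hmin)
  have : (3 : ℕ∞) ≤ 2 := ht.trans (hle.trans (by exact_mod_cast Finset.card_le_two))
  norm_num at this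

theorem pderiv_pderiv_ternaryCubic_eval (c : Fin 10 → k) (p q : Fin 3 → k) :
    ((Matrix.of fun i j => pderiv i (pderiv j (ternaryCubic c))).map (eval p)).mulVec q =
      ![(6 * c 0 * p 0 + 2 * c 3 * p 1 + 2 * c 4 * p 2) * q 0 +
          (2 * c 3 * p 0 + 2 * c 5 * p 1 + c 9 * p 2) * q 1 +
          (2 * c 4 * p 0 + c 9 * p 1 + 2 * c 7 * p 2) * q 2,
        (2 * c 3 * p 0 + 2 * c 5 * p 1 + c 9 * p 2) * q 0 +
          (6 * c 1 * p 1 + 2 * c 5 * p 0 + 2 * c 6 * p 2) * q 1 +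
          (c 9 * p 0 + 2 * c 6 * p 1 + 2 * c 8 * p 2) * q 2,
        (2 * c 4 * p 0 + c 9 * p 1 + 2 * c 7 * p 2) * q 0 +
          (c 9 * p 0 + 2 * c 6 * p 1 + 2 * c 8 * p 2) * q 1 +
          (6 * c 2 * p 2 + 2 * c 7 * p 0 + 2 * c 8 * p 1) * q 2] := by
  obtain ⟨d0, d1, d2⟩ := pderiv_ternaryCubic c
  ext i
  rw [Matrix.mulVec, dotProduct, Fin.sum_univ_three]
  simp only [Matrix.map_apply, Matrix.of_apply, d0, d1, d2]
  fin_cases i <;> simp only [Fin.zero_eta, Fin.mk_one, Fin.reduceFinMk, map_add,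
    Derivation.leibniz, Derivation.leibniz_pow, pderiv_C, pderiv_X_self, smul_eq_mul, nsmul_eq_mul,
    pderiv_X_fin_three, map_mul, eval_C, map_pow, eval_X, map_natCast, map_zero, map_one,
    Matrix.cons_val] <;> push_cast <;> ring

/-- A smooth plane cubic has a flex `p`: there is a line through `p`, spanned by `p` and `q`, on
which the form restricts to a cube. The direction `q` is a null vector of the Hessian matrix
at `p`. -/
theorem exists_flex [IsAlgClosed k] [CharZero k] {c : Fin 10 → k}
    (hs : IsSmoothForm (ternaryCubic c)) :
    ∃ p q : Fin 3 → k, LinearIndependent k ![p, q] ∧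
      ∀ s u : k, eval (s • p + u • q) (ternaryCubic c) = u ^ 3 * eval q (ternaryCubic c) := by
  have hH0 : eval 0 (hessian (ternaryCubic c)) = 0 := by
    rw [hessian, RingHom.map_det, RingHom.mapMatrix_apply]
    refine Matrix.exists_mulVec_eq_zero_iff.1 ⟨![1, 0, 0], by simp, ?_⟩
    rw [pderiv_pderiv_ternaryCubic_eval]
    simp
  obtain ⟨p, hp, hgp, hHp⟩ := exists_common_zero (f := ternaryCubic c)
    (by rw [eval_ternaryCubic]; simp) hH0
  rw [hessian, RingHom.map_det, RingHom.mapMatrix_apply] at hHp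
  obtain ⟨q, hq, hMq⟩ := Matrix.exists_mulVec_eq_zero_iff.2 hHp
  have hMp : ((Matrix.of fun i j => pderiv i (pderiv j (ternaryCubic c))).map (eval p)).mulVec p ≠
      0 := by
    intro h0
    obtain ⟨i, hi⟩ := hs p hp hgp
    refine hi ?_
    rw [pderiv_pderiv_ternaryCubic_eval] at h0
    have e0 := congrFun h0 0
    have e1 := congrFun h0 1
    have e2 := congrFun h0 2
    simp only [Matrix.cons_val, Pi.zero_apply] at e0 e1 e2
    obtain ⟨d0, d1, d2⟩ := pderiv_ternaryCubic c
    fin_cases i <;> simp only [Fin.zero_eta, Fin.mk_one, Fin.reduceFinMk, d0, d1, d2, map_add,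
      map_mul, eval_C, map_pow, eval_X]
    · linear_combination e0 / 2
    · linear_combination e1 / 2
    · linear_combination e2 / 2
  refine ⟨p, q, ?_, fun s u => ?_⟩
  · refine LinearIndependent.pair_iff.2 fun s t hst => ?_
    have h1 : s • ((Matrix.of fun i j => pderiv i (pderiv j (ternaryCubic c))).map
        (eval p)).mulVec p = 0 := by
      have := congrArg (Matrix.mulVec ((Matrix.of fun i j =>
        pderiv i (pderiv j (ternaryCubic c))).map (eval p))) hst
      rwa [Matrix.mulVec_add, Matrix.mulVec_smul, Matrix.mulVec_smul, hMq, smul_zero, add_zero,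
        Matrix.mulVec_zero] at this
    have hs0 : s = 0 := (smul_eq_zero.1 h1).resolve_right hMp
    refine ⟨hs0, ?_⟩
    rw [hs0, zero_smul, zero_add] at hst
    exact (smul_eq_zero.1 hst).resolve_right hq
  · rw [pderiv_pderiv_ternaryCubic_eval] at hMq
    have e0 := congrFun hMq 0
    have e1 := congrFun hMq 1
    have e2 := congrFun hMq 2
    simp only [Matrix.cons_val, Pi.zero_apply] at e0 e1 e2
    rw [eval_ternaryCubic] at hgp
    simp only [eval_ternaryCubic, Pi.add_apply, Pi.smul_apply, smul_eq_mul]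
    linear_combination s ^ 3 * hgp + (s ^ 2 * u / 2) * (p 0 * e0 + p 1 * e1 + p 2 * e2) +
      (s * u ^ 2 / 2) * (q 0 * e0 + q 1 * e1 + q 2 * e2)

end Flex

/-! ### Reduction of a smooth cubic to the Hesse normal form -/

section NormalForm

variable {k : Type*} [Field k]

theorem IsSmoothForm.of_projEquiv {n : ℕ} {f g : MvPolynomial (Fin n) k} (h : ProjEquiv f g)
    (hf : IsSmoothForm f) : IsSmoothForm g := by
  obtain ⟨A, c, rfl⟩ := h
  set B : Matrix (Fin n) (Fin n) k := A.1 with hB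
  have hdet : B.det ≠ 0 := left_ne_zero_of_mul_eq_one (b := (A⁻¹).1.det) (by
    rw [← Matrix.det_mul, hB, ← Units.val_mul, mul_inv_cancel, Units.val_one, Matrix.det_one])
  intro v hv h0
  rw [smul_eval, eval_linSubst] at h0
  have hBv : B.mulVec v ≠ 0 := fun h =>
    hdet (Matrix.exists_mulVec_eq_zero_iff.1 ⟨v, hv, h⟩)
  obtain ⟨i, hi⟩ := hf _ hBv ((mul_eq_zero.1 h0).resolve_left c.ne_zero)
  by_contra! hcon
  refine hdet ?_
  rw [← Matrix.det_transpose]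
  refine Matrix.exists_mulVec_eq_zero_iff.1
    ⟨fun j => eval (B.mulVec v) (pderiv j f), fun h => hi (congrFun h i), funext fun j => ?_⟩
  have := hcon j
  rw [Derivation.map_smul, smul_eval, pderiv_linSubst] at this
  have := (mul_eq_zero.1 this).resolve_left c.ne_zero
  simpa [Matrix.mulVec, dotProduct, map_sum, eval_linSubst] using this

theorem isHomogeneous_of_projEquiv {n d : ℕ} {f g : MvPolynomial (Fin n) k} (h : ProjEquiv f g)
    (hf : f.IsHomogeneous d) : g.IsHomogeneous d := by
  obtain ⟨A, c, rfl⟩ := h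
  simpa [smul_eq_C_mul] using (isHomogeneous_C (Fin n) (c : k)).mul (isHomogeneous_linSubst A.1 hf)

/-- After a change of coordinates the flex is `(0 : 1 : 0)` and its tangent line is `z = 0`. -/
theorem exists_projEquiv_flex_form [IsAlgClosed k] [CharZero k] {g : MvPolynomial (Fin 3) k}
    (hg : g.IsHomogeneous 3) (hs : IsSmoothForm g) :
    ∃ c : Fin 10 → k, ProjEquiv g (ternaryCubic c) ∧ c 1 = 0 ∧ c 3 = 0 ∧ c 5 = 0 := by
  obtain ⟨c, rfl⟩ := hg.exists_eq_ternaryCubic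
  obtain ⟨p, q, hpq, hflex⟩ := exists_flex hs
  have hcross := crossProduct_ne_zero_iff_linearIndependent.2 hpq
  obtain ⟨r, hr⟩ : ∃ r : Fin 3 → k, (!![q 0, p 0, r 0; q 1, p 1, r 1; q 2, p 2, r 2]).det ≠ 0 := by
    obtain ⟨i, hi⟩ := Function.ne_iff.1 hcross
    rw [cross_apply] at hi
    fin_cases i
    · refine ⟨![1, 0, 0], fun h => hi ?_⟩
      simp [Matrix.det_fin_three] at h ⊢
      linear_combination -h
    · refine ⟨![0, 1, 0], fun h => hi ?_⟩
      simp [Matrix.det_fin_three] at h ⊢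
      linear_combination -h
    · refine ⟨![0, 0, 1], fun h => hi ?_⟩
      simp [Matrix.det_fin_three] at h ⊢
      linear_combination -h
  set A := !![q 0, p 0, r 0; q 1, p 1, r 1; q 2, p 2, r 2] with hA
  have hAg : ProjEquiv (ternaryCubic c) (linSubst A (ternaryCubic c)) :=
    projEquiv_of_eval_of_det_ne_zero hr one_ne_zero fun v => by rw [eval_linSubst, one_mul]
  obtain ⟨d, hd⟩ := (isHomogeneous_of_projEquiv hAg hg).exists_eq_ternaryCubic
  rw [hd] at hAg
  refine ⟨d, hAg, ?_⟩
  have key : ∀ s u : k, eval ![u, s, 0] (ternaryCubic d) = u ^ 3 * eval q (ternaryCubic c) := by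
    intro s u
    rw [← hd, eval_linSubst, ← hflex s u]
    congr 2
    ext i
    fin_cases i <;> simp [hA, Matrix.mulVec, dotProduct, Fin.sum_univ_three] <;> ring
  have k1 := key 1 0
  have k2 := key 0 1
  have k3 := key 1 1
  have k4 := key 1 (-1)
  simp [eval_ternaryCubic] at k1 k2 k3 k4
  refine ⟨k1, ?_, ?_⟩
  · linear_combination (k3 + k4) / 2 - k1
  · linear_combination (k3 - k4) / 2 - k2

/-- A smooth cubic in flex form is `c₀ M³ + c₆ L₁ L₂ L₃`, where `z = L₃` is the tangent line at the
given flex, `L₁` and `L₂` are the tangent lines at two further flexes and the line `M` passes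
through all three. Writing the tangent lines as `y ± (mx + nz)` after completing the square, the
parameters are found from a root of a quartic. -/
theorem exists_three_flex_parameters [IsAlgClosed k] [CharZero k] {c₀ c₆ α β γ : k} (h0 : c₀ ≠ 0)
    (h6 : c₆ ≠ 0) : ∃ x₀ m n : k, α = -3 * c₀ * x₀ - c₆ * m ^ 2 ∧
      β = 3 * c₀ * x₀ ^ 2 - 2 * c₆ * m * n ∧ γ = -c₀ * x₀ ^ 3 - c₆ * n ^ 2 := by
  obtain ⟨x, hx⟩ : ∃ x : k, (3 * c₀ * x ^ 2 - β) ^ 2 =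
      4 * (α + 3 * c₀ * x) * (c₀ * x ^ 3 + γ) := by
    have hdeg : (Polynomial.C (-3 * c₀ ^ 2) * Polynomial.X ^ 4 +
        (Polynomial.C (-4 * α * c₀) * Polynomial.X ^ 3 + Polynomial.C (-6 * c₀ * β) *
          Polynomial.X ^ 2 + Polynomial.C (-12 * c₀ * γ) * Polynomial.X +
          Polynomial.C (β ^ 2 - 4 * α * γ))).degree = 4 := by
      have hne : -3 * c₀ ^ 2 ≠ 0 := mul_ne_zero (by norm_num) (pow_ne_zero 2 h0)
      compute_degree!
    obtain ⟨x, hx⟩ := IsAlgClosed.exists_root _ (by rw [hdeg]; norm_num)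
    refine ⟨x, ?_⟩
    simp only [Polynomial.IsRoot, Polynomial.eval_add, Polynomial.eval_mul, Polynomial.eval_C,
      Polynomial.eval_pow, Polynomial.eval_X] at hx
    linear_combination hx
  obtain ⟨m, hm⟩ := IsAlgClosed.exists_pow_nat_eq (-(α + 3 * c₀ * x) / c₆) (n := 2) (by norm_num)
  rw [eq_div_iff h6] at hm
  by_cases hm0 : m = 0
  · obtain ⟨n, hn⟩ := IsAlgClosed.exists_pow_nat_eq (-(c₀ * x ^ 3 + γ) / c₆) (n := 2) (by norm_num)
    rw [eq_div_iff h6] at hn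
    rw [hm0] at hm
    have hα : α + 3 * c₀ * x = 0 := by linear_combination hm
    have hβ : 3 * c₀ * x ^ 2 - β = 0 := by
      rw [hα] at hx
      exact eq_zero_of_pow_eq_zero (n := 2) (by linear_combination hx)
    refine ⟨x, m, n, ?_, ?_, ?_⟩
    · rw [hm0]
      linear_combination hα
    · rw [hm0]
      linear_combination -hβ
    · linear_combination hn
  · refine ⟨x, m, (3 * c₀ * x ^ 2 - β) / (2 * c₆ * m), ?_, ?_, ?_⟩
    · linear_combination hm
    · field_simp
      ring
    · have h4 : 4 * c₆ * m ^ 2 ≠ 0 := by simp [h6, hm0]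
      refine mul_left_cancel₀ h4 ?_
      field_simp
      linear_combination hx + 4 * (c₀ * x ^ 3 + γ) * hm

/-- If `a³ = 1`, the curve is a triangle with vertex `(a : a : 1)`. -/
theorem pow_three_ne_one_of_isSmoothForm [CharZero k] {a : k}
    (hs : IsSmoothForm (hesseCubic a)) : a ^ 3 ≠ 1 := by
  intro ha
  have ha0 : a ≠ 0 := by
    rintro rfl
    simp at ha
  rw [hesseCubic_eq_hessePencil] at hs
  obtain ⟨d0, d1, d2⟩ := pderiv_hessePencil 1 a
  obtain ⟨i, hi⟩ := hs ![a, a, 1] (fun h => by simpa using congrFun h 2) (by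
    simp [eval_hessePencil]
    linear_combination -ha)
  refine hi ?_
  fin_cases i <;> simp [d0, d1, d2]
  · ring
  · ring
  · linear_combination -3 * ha

/-- The normal form `κ X³ + Y³ + Z³ - 3 λ XYZ` is a member of the Hesse pencil up to scaling. -/
theorem projEquiv_hesseCubic_of_eval [IsAlgClosed k] [CharZero k] {g : MvPolynomial (Fin 3) k}
    (hs : IsSmoothForm g) {κ l : k} (hg : ∀ v, eval v g = κ * v 0 ^ 3 + v 1 ^ 3 + v 2 ^ 3 -
      3 * l * (v 0 * v 1 * v 2)) : ∃ a : k, a ^ 3 ≠ 1 ∧ ProjEquiv g (hesseCubic a) := by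
  have hgc : g = ternaryCubic ![κ, 1, 1, 0, 0, 0, 0, 0, 0, -3 * l] :=
    MvPolynomial.funext fun v => by
      rw [hg, eval_ternaryCubic]
      simp
      ring
  have hκ : κ ≠ 0 := by
    rintro rfl
    obtain ⟨d0, d1, d2⟩ := pderiv_ternaryCubic ![0, 1, 1, 0, 0, 0, 0, 0, 0, -3 * l]
    obtain ⟨i, hi⟩ := hs ![1, 0, 0] (fun h => by simpa using congrFun h 0) (by simp [hg])
    refine hi ?_
    rw [hgc]
    fin_cases i <;> simp only [Fin.zero_eta, Fin.mk_one, Fin.reduceFinMk, d0, d1, d2] <;> simp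
  obtain ⟨μ, hμ⟩ := IsAlgClosed.exists_pow_nat_eq κ (n := 3) (by norm_num)
  have hμ0 : μ ≠ 0 := by
    rintro rfl
    exact hκ (by rw [← hμ, zero_pow three_ne_zero])
  have h : ProjEquiv g (hesseCubic (l / μ)) := by
    refine projEquiv_of_eval_of_det_ne_zero (A := Matrix.diagonal ![μ⁻¹, 1, 1]) ?_ one_ne_zero
      fun v => ?_
    · simp [Fin.prod_univ_three, hμ0]
    · simp only [hesseCubic_eq_hessePencil, eval_hessePencil, Matrix.mulVec_diagonal, hg]
      simp only [Matrix.cons_val]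
      field_simp
      linear_combination (v 0 ^ 3) * hμ
  exact ⟨_, pow_three_ne_one_of_isSmoothForm (hs.of_projEquiv h), h⟩

/-- **Hesse normal form**: over an algebraically closed field of characteristic zero every smooth
plane cubic is projectively equivalent to some `x³ + y³ + z³ - 3axyz` with `a³ ≠ 1`. -/
theorem exists_projEquiv_hesseCubic [IsAlgClosed k] [CharZero k] {g : MvPolynomial (Fin 3) k}
    (hg : g.IsHomogeneous 3) (hs : IsSmoothForm g) :
    ∃ a : k, a ^ 3 ≠ 1 ∧ ProjEquiv g (hesseCubic a) := by
  obtain ⟨c, hgc, h1, h3, h5⟩ := exists_projEquiv_flex_form hg hs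
  replace hs := hs.of_projEquiv hgc
  suffices h : ∃ a : k, a ^ 3 ≠ 1 ∧ ProjEquiv (ternaryCubic c) (hesseCubic a) by
    obtain ⟨a, ha, h⟩ := h
    exact ⟨a, ha, hgc.trans h⟩
  obtain ⟨d0, d1, d2⟩ := pderiv_ternaryCubic c
  -- Smoothness at the flex.
  have h6 : c 6 ≠ 0 := by
    intro h6
    obtain ⟨i, hi⟩ := hs ![0, 1, 0] (fun h => by simpa using congrFun h 1)
      (by simp [eval_ternaryCubic, h1])
    refine hi ?_
    fin_cases i <;> simp [d0, d1, d2, h1, h5, h6]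
  -- The tangent line at the flex is not a component.
  have h0 : c 0 ≠ 0 := by
    intro h0
    obtain ⟨y, hy⟩ : ∃ y : k, c 6 * (y * y) + c 9 * y + c 4 = 0 := by
      obtain ⟨s, hs⟩ := IsAlgClosed.exists_pow_nat_eq (discrim (c 6) (c 9) (c 4)) (n := 2)
        (by norm_num)
      exact exists_quadratic_eq_zero h6 ⟨s, by rw [← hs]; ring⟩
    obtain ⟨i, hi⟩ := hs ![1, y, 0] (fun h => by simpa using congrFun h 0)
      (by simp [eval_ternaryCubic, h0, h1, h3, h5])
    refine hi ?_
    fin_cases i <;> simp [d0, d1, d2, h0, h1, h3, h5]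
    linear_combination hy
  obtain ⟨H, hH⟩ : ∃ H, c 8 = 2 * c 6 * H := ⟨c 8 / (2 * c 6), by field_simp⟩
  obtain ⟨K, hK⟩ : ∃ K, c 9 = 2 * c 6 * K := ⟨c 9 / (2 * c 6), by field_simp⟩
  obtain ⟨x, m, n, hα, hβ, hγ⟩ := exists_three_flex_parameters (α := c 4 - c 6 * K ^ 2)
    (β := c 7 - 2 * c 6 * H * K) (γ := c 2 - c 6 * H ^ 2) h0 h6
  have h4 : c 4 = c 6 * K ^ 2 - 3 * c 0 * x - c 6 * m ^ 2 := by linear_combination hα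
  have h7 : c 7 = 2 * c 6 * H * K + 3 * c 0 * x ^ 2 - 2 * c 6 * m * n := by linear_combination hβ
  have h2 : c 2 = c 6 * H ^ 2 - c 0 * x ^ 3 - c 6 * n ^ 2 := by linear_combination hγ
  have hform : ∀ v : Fin 3 → k, eval v (ternaryCubic c) = c 0 * (v 0 - x * v 2) ^ 3 +
      c 6 * (v 1 + K * v 0 + H * v 2 - m * v 0 - n * v 2) *
        (v 1 + K * v 0 + H * v 2 + m * v 0 + n * v 2) * v 2 := by
    intro v
    rw [eval_ternaryCubic, h1, h2, h3, h4, h5, h7, hH, hK]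
    ring
  -- The three tangent lines are not concurrent on the line through the flexes.
  have he : n + m * x ≠ 0 := by
    intro he
    have hn : n = -(m * x) := by linear_combination he
    obtain ⟨i, hi⟩ := hs ![x, -(K * x + H), 1] (fun h => by simpa using congrFun h 2) (by
      rw [hform, hn]
      simp)
    refine hi ?_
    fin_cases i <;> simp [d0, d1, d2, h1, h2, h3, h4, h5, h7, hH, hK, hn] <;> ring
  obtain ⟨ω, hω⟩ := exists_cube_root_of_unity (k := k)
  -- New coordinates in which `L₁`, `-L₂`, `e L₃` are the linear factors of the norm form.
  obtain ⟨e, he'⟩ : ∃ e, e = 2 * (n + m * x) := ⟨_, rfl⟩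
  have he0 : e ≠ 0 := he' ▸ mul_ne_zero two_ne_zero he
  obtain ⟨l, hl⟩ : ∃ l, l = -(2 * m / 3) := ⟨_, rfl⟩
  set A : Matrix (Fin 3) (Fin 3) k :=
    !![1 + x * (l / e), x * (ω ^ 2 / e), x * (ω / e);
       l + (m - K) * (1 + x * (l / e)) + (n - H) * (l / e),
       1 + (m - K) * (x * (ω ^ 2 / e)) + (n - H) * (ω ^ 2 / e),
       1 + (m - K) * (x * (ω / e)) + (n - H) * (ω / e);
       l / e, ω ^ 2 / e, ω / e] with hA
  have hdet : A.det ≠ 0 := by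
    have : A.det = (ω - ω ^ 2) / e := by
      rw [hA, Matrix.det_fin_three]
      simp
      field_simp
      ring
    rw [this]
    refine div_ne_zero (fun h => ?_) he0
    have : (3 : k) = 0 := by
      linear_combination ω ^ 2 * (1 - ω ^ 2) * h + (-3 * (ω - 1) - ω ^ 3 * (ω - 2)) * hω
    norm_num at this
  have hAg : ProjEquiv (ternaryCubic c) ((-(e / c 6)) • linSubst A (ternaryCubic c)) :=
    projEquiv_of_eval_of_det_ne_zero hdet (neg_ne_zero.2 (div_ne_zero he0 h6))
      fun v => by rw [smul_eval, eval_linSubst]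
  obtain ⟨a, ha, h⟩ := projEquiv_hesseCubic_of_eval (hs.of_projEquiv hAg)
    (κ := l ^ 3 - e * c 0 / c 6) (l := l) fun v => by
      have hN := norm_form_eq_mul hω (l * v 0) (v 1) (v 2)
      have w2 : A.mulVec v 2 = (l * v 0 + ω ^ 2 * v 1 + ω * v 2) / e := by
        simp [hA, Matrix.mulVec, dotProduct, Fin.sum_univ_three]
        ring
      have w0 : A.mulVec v 0 = v 0 + x * A.mulVec v 2 := by
        rw [w2]
        simp [hA, Matrix.mulVec, dotProduct, Fin.sum_univ_three]
        ring
      have w1 : A.mulVec v 1 = l * v 0 + v 1 + v 2 + (m - K) * A.mulVec v 0 +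
          (n - H) * A.mulVec v 2 := by
        rw [w0, w2]
        simp [hA, Matrix.mulVec, dotProduct, Fin.sum_univ_three]
        ring
      have w2' : e * A.mulVec v 2 = l * v 0 + ω ^ 2 * v 1 + ω * v 2 := by
        rw [w2]
        field_simp
      rw [smul_eval, eval_linSubst, hform, w1, w0]
      generalize A.mulVec v 2 = z at *
      have hL₂ : -(2 * m * v 0 + e * z + l * v 0 + v 1 + v 2) =
          l * v 0 + ω * v 1 + ω ^ 2 * v 2 := by
        rw [w2', hl]
        linear_combination (-v 1 - v 2) * hω
      have hprod : -(e / c 6) * (c 0 * v 0 ^ 3 + c 6 * (l * v 0 + v 1 + v 2) *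
          (2 * m * v 0 + e * z + l * v 0 + v 1 + v 2) * z) = -(e * c 0 / c 6) * v 0 ^ 3 +
          (l * v 0 + v 1 + v 2) * -(2 * m * v 0 + e * z + l * v 0 + v 1 + v 2) * (e * z) := by
        field_simp
        ring
      linear_combination hprod + hN + (l * v 0 + v 1 + v 2) * (e * z) * hL₂ +
        (l * v 0 + v 1 + v 2) * (l * v 0 + ω * v 1 + ω ^ 2 * v 2) * w2' +
        (e / c 6) * c 6 * (l * v 0 + v 1 + v 2) * z ^ 2 * he'
  exact ⟨a, ha, hAg.trans h⟩

end NormalForm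

/-! ### The four classes -/

section Classes

variable {k : Type*} [Field k]

theorem isSmoothForm_hesseCubic [CharZero k] {a : k} (ha : a ^ 3 ≠ 1) :
    IsSmoothForm (hesseCubic a) := by
  intro v hv _
  by_contra! hcon
  rw [hesseCubic_eq_hessePencil] at hcon
  obtain ⟨d0, d1, d2⟩ := pderiv_hessePencil 1 a
  have e0 := hcon 0
  have e1 := hcon 1
  have e2 := hcon 2
  simp only [d0, d1, d2, map_sub, map_mul, eval_C, map_pow, eval_X] at e0 e1 e2
  have ha' : 1 - a ^ 3 ≠ 0 := sub_ne_zero.2 ha.symm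
  have z1 : v 0 * v 1 * v 2 = 0 := by
    by_contra hne
    have : (1 - a ^ 3) * (v 0 * v 1 * v 2) ^ 2 = 0 := by
      linear_combination (v 1 ^ 2 * v 2 ^ 2) / 3 * e0 + a * v 1 * v 2 * v 2 ^ 2 / 3 * e1 +
        a ^ 2 * v 1 * v 2 * v 0 * v 2 / 3 * e2
    exact pow_ne_zero 2 hne ((mul_eq_zero.1 this).resolve_left ha')
  have w0 : v 0 = 0 := eq_zero_of_pow_eq_zero (n := 3) (by linear_combination v 0 / 3 * e0 + a * z1)
  have w1 : v 1 = 0 := eq_zero_of_pow_eq_zero (n := 3) (by linear_combination v 1 / 3 * e1 + a * z1)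
  have w2 : v 2 = 0 := eq_zero_of_pow_eq_zero (n := 3) (by linear_combination v 2 / 3 * e2 + a * z1)
  refine hv (funext fun i => ?_)
  fin_cases i
  exacts [w0, w1, w2]

/-- The member of the Hesse pencil with parameter `a`, as a smooth plane cubic. -/
noncomputable def smoothHesseCubic {k : Type*} [Field k] [CharZero k] (a : k) (ha : a ^ 3 ≠ 1) :
    SmoothPlaneCubic k :=
  ⟨hesseCubic a, by rw [hesseCubic_eq_hessePencil]; exact isHomogeneous_hessePencil 1 a,
    isSmoothForm_hesseCubic ha⟩

theorem hessian_hesseCubic [CharZero k] {a : k} (ha : a ≠ 0) :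
    hessian (hesseCubic a) = (-54 * a ^ 2) • hesseCubic ((4 - a ^ 3) / (3 * a ^ 2)) := by
  rw [hesseCubic_eq_hessePencil, hesseCubic_eq_hessePencil, hessian_hessePencil, smul_hessePencil,
    smul_hessePencil]
  congr 1
  · ring
  · field_simp
    ring

/-- For `a ≠ 0` the condition on `f_a` is that `Mac(f_a) = f_c` and `Hess(f_a) = f_b` are
equivalent; in terms of the invariant `J` of `f_a` the invariants of these are `4096 / J` and
`-(J - 256)³ / (27 J²)`, unless `J = 0`, where both are triangles. -/
theorem macaulayEquivHessian_hesseCubic_iff [IsAlgClosed k] [CharZero k] {a : k} (ha0 : a ≠ 0)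
    (ha : a ^ 3 ≠ 1) : MacaulayEquivHessian 3 (hesseCubic a) ↔
      hesseInvariant a * (hesseInvariant a - 64) * (hesseInvariant a ^ 2 - 704 * hesseInvariant a
        + 262144) = 0 := by
  set b := (4 - a ^ 3) / (3 * a ^ 2) with hb
  set c := -2 / a with hc
  have hH := hessian_hesseCubic ha0
  have h54 : -54 * a ^ 2 ≠ 0 := mul_ne_zero (by norm_num) (pow_ne_zero 2 ha0)
  have h1 : MacaulayEquivHessian 3 (hesseCubic a) ↔ ProjEquiv (hesseCubic c) (hesseCubic b) := by
    constructor
    · rintro ⟨f, hf, hfH⟩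
      obtain ⟨r, hr, rfl⟩ := hf.eq_smul_hesseCubic ha0 ha
      rw [hH] at hfH
      exact (projEquiv_smul _ hr).trans (hfH.trans (projEquiv_smul _ h54).symm)
    · intro h
      refine ⟨_, isMacaulayPolynomial_hesseCubic ha0 ha, ?_⟩
      rw [hH]
      exact h.trans (projEquiv_smul _ h54)
  rw [h1]
  have hW : a ^ 3 - 1 ≠ 0 := sub_ne_zero.2 ha
  have hc1 : c ^ 3 - 1 = -(a ^ 3 + 8) / a ^ 3 := by
    rw [hc]
    field_simp
    ring
  have hb1 : b ^ 3 - 1 = -((a ^ 3 - 1) * (a ^ 3 + 8) ^ 2) / (27 * (a ^ 3) ^ 2) := by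
    rw [hb]
    field_simp
    ring
  by_cases h8 : a ^ 3 + 8 = 0
  · have hJ : hesseInvariant a = 0 := by simp [hesseInvariant, h8]
    rw [hJ]
    simp only [zero_mul, iff_true]
    refine projEquiv_hesseCubic_of_pow_eq ?_
    rw [h8] at hc1 hb1
    simp at hc1 hb1
    linear_combination hc1 - hb1
  have ha3 : a ^ 3 ≠ 0 := pow_ne_zero 3 ha0
  have hJ : hesseInvariant a ≠ 0 := by
    rw [hesseInvariant]
    exact div_ne_zero (mul_ne_zero ha3 (pow_ne_zero 3 h8)) (pow_ne_zero 3 hW)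
  have hc3 : c ^ 3 ≠ 1 := by
    rw [← sub_ne_zero, hc1]
    exact div_ne_zero (neg_ne_zero.2 h8) ha3
  have hb3 : b ^ 3 ≠ 1 := by
    rw [← sub_ne_zero, hb1]
    exact div_ne_zero (neg_ne_zero.2 (mul_ne_zero hW (pow_ne_zero 2 h8)))
      (mul_ne_zero (by norm_num) (pow_ne_zero 2 ha3))
  have hJc : hesseInvariant c = 4096 / hesseInvariant a := by
    have e8 : c ^ 3 + 8 = 8 * (a ^ 3 - 1) / a ^ 3 := by
      rw [hc]
      field_simp
      ring
    have e0 : c ^ 3 = -8 / a ^ 3 := by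
      rw [hc]
      field_simp
      ring
    rw [hesseInvariant, hesseInvariant, hc1, e8, e0]
    field_simp
    ring
  have hJb : hesseInvariant b = -(hesseInvariant a - 256) ^ 3 / (27 * hesseInvariant a ^ 2) := by
    have e8 : b ^ 3 + 8 = -((a ^ 3) ^ 3 - 228 * (a ^ 3) ^ 2 + 48 * a ^ 3 - 64) /
        (27 * (a ^ 3) ^ 2) := by
      rw [hb]
      field_simp
      ring
    have e0 : b ^ 3 = (4 - a ^ 3) ^ 3 / (27 * (a ^ 3) ^ 2) := by
      rw [hb]
      field_simp
      ring
    have e256 : hesseInvariant a - 256 = (a ^ 3 - 4) * ((a ^ 3) ^ 3 - 228 * (a ^ 3) ^ 2 +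
        48 * a ^ 3 - 64) / (a ^ 3 - 1) ^ 3 := by
      rw [hesseInvariant]
      field_simp
      ring
    rw [e256, hesseInvariant, hesseInvariant, hb1, e8, e0]
    generalize a ^ 3 = t at *
    field_simp
    ring
  have h2 : ProjEquiv (hesseCubic c) (hesseCubic b) ↔ hesseInvariant c = hesseInvariant b :=
    ⟨hesseInvariant_eq_of_projEquiv hc3, projEquiv_of_hesseInvariant_eq hc3 hb3⟩
  rw [h2, hJc, hJb]
  generalize hesseInvariant a = J at hJ
  rw [div_eq_div_iff hJ (mul_ne_zero (by norm_num) (pow_ne_zero 2 hJ))]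
  constructor
  · intro h
    linear_combination h
  · intro h
    linear_combination h

theorem exists_hesseInvariant_eq [IsAlgClosed k] [CharZero k] (J : k) :
    ∃ a : k, a ^ 3 ≠ 1 ∧ hesseInvariant a = J := by
  obtain ⟨t, ht⟩ : ∃ t : k, t * (t + 8) ^ 3 = J * (t - 1) ^ 3 := by
    have hdeg : (Polynomial.C (1 : k) * Polynomial.X ^ 4 +
        (Polynomial.C (24 - J) * Polynomial.X ^ 3 + Polynomial.C (192 + 3 * J) *
          Polynomial.X ^ 2 + Polynomial.C (512 - 3 * J) * Polynomial.X +
          Polynomial.C J)).degree = 4 := by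
      compute_degree!
    obtain ⟨x, hx⟩ := IsAlgClosed.exists_root _ (by rw [hdeg]; norm_num)
    refine ⟨x, ?_⟩
    simp only [Polynomial.IsRoot, Polynomial.eval_add, Polynomial.eval_mul, Polynomial.eval_C,
      Polynomial.eval_pow, Polynomial.eval_X] at hx
    linear_combination hx
  obtain ⟨a, ha⟩ := IsAlgClosed.exists_pow_nat_eq t (n := 3) (by norm_num)
  have ht1 : t ≠ 1 := by
    rintro rfl
    norm_num at ht
  refine ⟨a, by rwa [ha], ?_⟩
  rw [hesseInvariant, ha, ht]
  exact mul_div_cancel_right₀ _ (pow_ne_zero 3 (sub_ne_zero.2 ht1))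

/-- The Fermat cubic `f_0` is equivalent to `f_{-2}`, so the parameter `0` can be avoided. -/
theorem exists_projEquiv_hesseCubic_ne_zero [IsAlgClosed k] [CharZero k]
    (g : SmoothPlaneCubic k) :
    ∃ a : k, a ≠ 0 ∧ a ^ 3 ≠ 1 ∧ ProjEquiv g.1 (hesseCubic a) := by
  obtain ⟨a, ha, h⟩ := exists_projEquiv_hesseCubic g.2.1 g.2.2
  by_cases ha0 : a = 0
  · subst ha0
    obtain ⟨ω, hω⟩ := exists_cube_root_of_unity (k := k)
    refine ⟨-2, by norm_num, by norm_num, h.trans ?_⟩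
    have := projEquiv_hesseCubic_fourier hω (zero_ne_one (α := k))
    rwa [show ((0 : k) + 2) / (0 - 1) = -2 by norm_num] at this
  · exact ⟨a, ha0, ha, h⟩

/-- The four values of the invariant for which the Macaulay polynomial and the Hessian are
equivalent. -/
theorem exists_finset_card_eq_four [IsAlgClosed k] [CharZero k] :
    ∃ V : Finset k, V.card = 4 ∧
      ∀ J, J ∈ V ↔ J * (J - 64) * (J ^ 2 - 704 * J + 262144) = 0 := by
  classical
  obtain ⟨s, hs⟩ := IsAlgClosed.exists_pow_nat_eq (-15 : k) (n := 2) (by norm_num)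
  have hne : ∀ m n : ℤ, m ^ 2 + 15 * n ^ 2 ≠ 0 → (m : k) + n * s ≠ 0 := by
    intro m n hmn h
    have : (m : k) ^ 2 + 15 * n ^ 2 = 0 := by
      linear_combination (m - n * s) * h + n ^ 2 * hs
    exact hmn (by exact_mod_cast this)
  have n1 := hne 352 96 (by norm_num)
  have n2 := hne 352 (-96) (by norm_num)
  have n3 := hne 288 96 (by norm_num)
  have n4 := hne 288 (-96) (by norm_num)
  have n5 := hne 0 192 (by norm_num)
  push_cast at n1 n2 n3 n4 n5
  refine ⟨{0, 64, 352 + 96 * s, 352 - 96 * s}, ?_, fun J => ?_⟩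
  · rw [Finset.card_insert_of_notMem, Finset.card_insert_of_notMem, Finset.card_pair]
    · exact fun h => n5 (by linear_combination h)
    · simp only [Finset.mem_insert, Finset.mem_singleton, not_or]
      exact ⟨fun h => n3 (by linear_combination -h), fun h => n4 (by linear_combination -h)⟩
    · simp only [Finset.mem_insert, Finset.mem_singleton, not_or]
      exact ⟨by norm_num, fun h => n1 (by linear_combination -h),
        fun h => n2 (by linear_combination -h)⟩
  · have hf : J * (J - 64) * (J ^ 2 - 704 * J + 262144) =
        J * (J - 64) * ((J - (352 + 96 * s)) * (J - (352 - 96 * s))) := by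
      linear_combination J * (J - 64) * 96 ^ 2 * hs
    rw [hf]
    simp only [Finset.mem_insert, Finset.mem_singleton, mul_eq_zero, sub_eq_zero]
    tauto

end Classes

theorem mainTheorem1 (k : Type*) [Field k] [IsAlgClosed k] [CharZero k] :
    (∃ S : Finset (Quotient (projSetoid k)), S.card = 4 ∧
      ∀ g : SmoothPlaneCubic k,
        Quotient.mk (projSetoid k) g ∈ S ↔ MacaulayEquivHessian 3 g.1) ∧
    (∀ a : k, a ≠ 0 → a ^ 3 ≠ 1 →
      (∃ r : k, r ≠ 0 ∧
        hessian (hesseCubic a) = r • hesseCubic ((4 - a ^ 3) / (3 * a ^ 2))) ∧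
      ∀ f : MvPolynomial (Fin 3) k,
        IsMacaulayPolynomial 3 (hesseCubic a) f ↔
          ∃ r : k, r ≠ 0 ∧ f = r • hesseCubic (-2 / a)) := by
  classical
  refine ⟨?_, fun a ha0 ha => ⟨⟨_, mul_ne_zero (by norm_num) (pow_ne_zero 2 ha0),
    hessian_hesseCubic ha0⟩, fun f => ⟨fun h => h.eq_smul_hesseCubic ha0 ha, ?_⟩⟩⟩
  · obtain ⟨V, hV, hVmem⟩ := exists_finset_card_eq_four (k := k)
    choose par hpar hinv using exists_hesseInvariant_eq (k := k)
    refine ⟨V.image fun J => Quotient.mk (projSetoid k) (smoothHesseCubic (par J) (hpar J)), ?_, ?_⟩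
    · rw [Finset.card_image_of_injective, hV]
      intro J J' h
      have h' : ProjEquiv (hesseCubic (par J)) (hesseCubic (par J')) := Quotient.exact h
      rw [← hinv J, ← hinv J']
      exact hesseInvariant_eq_of_projEquiv (hpar J) h'
    · intro g
      obtain ⟨a, ha0, ha, hga⟩ := exists_projEquiv_hesseCubic_ne_zero g
      have hMac : MacaulayEquivHessian 3 g.1 ↔ MacaulayEquivHessian 3 (hesseCubic a) :=
        ⟨fun h => h.of_projEquiv hga, fun h => h.of_projEquiv hga.symm⟩
      rw [hMac, macaulayEquivHessian_hesseCubic_iff ha0 ha, ← hVmem, Finset.mem_image]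
      constructor
      · rintro ⟨J, hJ, h⟩
        have h' : ProjEquiv (hesseCubic (par J)) g.1 := Quotient.exact h
        rwa [← hesseInvariant_eq_of_projEquiv (hpar J) (h'.trans hga), hinv]
      · intro h
        refine ⟨_, h, Quotient.sound ?_⟩
        exact (projEquiv_of_hesseInvariant_eq (hpar _) ha (hinv _)).trans hga.symm
  · rintro ⟨r, hr, rfl⟩
    exact isMacaulayPolynomial_smul hr (isMacaulayPolynomial_hesseCubic ha0 ha)
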